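/- \textbf{Variational Principle for positive strong submeasures.} \emph{Notions.} Let $X$ be a compact Hausdorff space and $C^0(X)$ the space of real continuous functions with the sup norm. A positive strong submeasure on $X$ is a functional $\mu:C^0(X)\to\mathbb R$ that is sublinear ($\mu(\varphi+\psi)\le\mu(\varphi)+\mu(\psi)$, and $\mu(\lambda\varphi)=\lambda\mu(\varphi)$ for $\lambda\ge 0$), bounded ($|\mu(\varphi)|\le C\|\varphi\|$ for some constant $C$) and non-decreasing; its mass is $\mu(1)$. A finite measure is identified with the functional $\varphi\mapsto\int\varphi\,d\nu$, and functionals are ordered pointwise, suprema being taken pointwise. For a continuous map $g:X\to Y$, $(g_*\mu)(\varphi)=\mu(\varphi\circ g)$. For a continuous $g:X\to X$ and a $g$-invariant regular Borel probability measure $\nu$, $h_\nu(g)$ denotes the measure-theoretic (Kolmogorov--Sinai) entropy, defined through finite Borel partitions, and $h_{top}(g)$ denotes the topological entropy; all entropies take values in $[-\infty,+\infty]$. \textbf{(1)} Let $X$ be a non-empty compact Hausdorff space and $f:X\to X$ continuous. For a positive strong submeasure $\mu$ with $f_*\mu=\mu$ put $$h_\mu(f)=\sup\{h_\nu(f):\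 \nu \text{ an } f\text{-invariant regular Borel probability measure},\ \nu\le\mu\}.$$ Then $h_\mu(f)\le h_{top}(f)$ for every $f$-invariant positive strong submeasure $\mu$ of mass $1$. Moreover the supremum $\mu$ of all $f$-invariant regular Borel probability measures is an $f$-invariant positive strong submeasure of mass $1$, and $h_\mu(f)=h_{top}(f)$. \textbf{(2)} Let $X$ be a non-empty compact metric space and $f:X\dashrightarrow X$ a continuous open-dense defined map, that is, a continuous map from an open dense subset of $X$ to $X$. Let $OpenDom(f)$ be the largest open set to which $f$ extends continuously; the extension is still denoted by $f$. For $\varphi\in C^0(X)$ let $f^*\varphi:X\to\mathbb R$ be equal to $\varphi\circ f$ on $OpenDom(f)$ and to $\limsup_{y\in OpenDom(f),\,y\to x}\varphi(f(y))$ at the points $x\notin OpenDom(f)$, and for a positive strong submeasure $\mu$ on $X$ let $$(f_*\mu)(\varphi)=\inf\{\mu(\psi):\ \psi\in C^0(X),\ \psi\ge f^*\varphi\}.$$ Assume that $f$ is good with respect to iterates: the set $\Omega_{f,\infty}$ of the points $x$ with $f^n(x)\in OpenDom(f)$ for all $n\ge 0$ is dense in $X$, and its complement is nowhere dense. Let $\Gamma_{f,\infty}$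 be the closure of $\{(x,f(x),f^2(x),\ldots):x\in\Omega_{f,\infty}\}$ in $X^{\mathbb N}$ with the product topology, $\phi_f:\Gamma_{f,\infty}\to\Gamma_{f,\infty}$ the shift map, and $\pi_1:\Gamma_{f,\infty}\to X$ the first projection. Put $h_{top}(f):=h_{top}(\phi_f)$, and for a positive strong submeasure $\mu$ on $X$ with $f_*\mu=\mu$ put $$h_\mu(f):=\sup\{h_\nu(\phi_f):\ \nu \text{ a } \phi_f\text{-invariant Borel probability measure on } \Gamma_{f,\infty},\ (\pi_1)_*\nu\le\mu\}.$$ Then $h_\mu(f)\le h_{top}(f)$ for every $f$-invariant positive strong submeasure $\mu$ of mass $1$, and the maximum is attained: $\max_\mu h_\mu(f)=h_{top}(f)$, where $\mu$ runs over all $f$-invariant positive strong submeasures of mass $1$. More precisely, let $\hat\mu$ be the supremum of all $\phi_f$-invariant Borel probability measures on $\Gamma_{f,\infty}$. Then $\hat\mu$ is a $\phi_f$-invariant positive strong submeasure of mass $1$ with $h_{\hat\mu}(\phi_f)=h_{top}(f)$; among the $f$-invariant positive strong submeasures $\mu$ on $X$ with $\mu\ge(\pi_1)_*\hat\mu$ there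 is a smallest one, and this smallest one has mass $1$ and satisfies $h_\mu(f)=h_{top}(f)$. -/

import Mathlib

open Set Filter Topology MeasureTheory

universe u v

namespace Submeasure

noncomputable section

/-! ### Strong submeasures -/

section Functionals

variable {X : Type u} {Y : Type v} [TopologicalSpace X] [TopologicalSpace Y]

/-- A strong submeasure on a compact space `X`: a sublinear functional on `C(X, ℝ)` which is bounded
for the sup norm. -/
structure IsStrongSubmeasure [CompactSpace X] (μ : C(X, ℝ) → ℝ) : Prop where
  add_le : ∀ φ ψ : C(X, ℝ), μ (φ + ψ) ≤ μ φ + μ ψ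
  smul_eq : ∀ (c : ℝ) (φ : C(X, ℝ)), 0 ≤ c → μ (c • φ) = c * μ φ
  bounded : ∃ C : ℝ, 0 < C ∧ ∀ φ : C(X, ℝ), |μ φ| ≤ C * ‖φ‖

/-- A positive strong submeasure: a strong submeasure which is non-decreasing. Its mass is `μ 1`. -/
structure IsPositiveStrongSubmeasure [CompactSpace X] (μ : C(X, ℝ) → ℝ) : Prop extends
    IsStrongSubmeasure μ where
  mono : ∀ φ ψ : C(X, ℝ), φ ≤ ψ → μ φ ≤ μ ψ

/-- Pushforward of a functional by a continuous map: `(g_* μ)(φ) = μ(φ ∘ g)`. -/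
def pushforward (g : C(X, Y)) (μ : C(X, ℝ) → ℝ) : C(Y, ℝ) → ℝ :=
  fun φ => μ (φ.comp g)

/-- The functional `φ ↦ ∫ φ dν` on `C(X, ℝ)` given by a measure `ν`. -/
def ofMeasure [MeasurableSpace X] (ν : Measure X) : C(X, ℝ) → ℝ :=
  fun φ => ∫ x, φ x ∂ν

/-- `μ = sup_{ν ∈ G} ν`: for each continuous `φ`, the number `μ(φ)` is the least upper bound
of the integrals `∫ φ dν`, `ν ∈ G`. -/
def IsSupOfMeasures [MeasurableSpace X] (G : Set (Measure X)) (μ : C(X, ℝ) → ℝ) : Prop :=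
  ∀ φ : C(X, ℝ), IsLUB ((fun ν => ofMeasure ν φ) '' G) (μ φ)

end Functionals

/-! ### Entropy of continuous self-maps -/

section MeasureEntropy

variable {X : Type u} [MeasurableSpace X]

/-- A finite family of measurable sets is a `ν`-partition if the members are pairwise disjoint up to
`ν`-null sets and their union has measure `1`. -/
structure IsMeasurePartition (ν : Measure X) {k : ℕ} (A : Fin k → Set X) : Prop where
  measurableSet : ∀ i, MeasurableSet (A i)
  measure_iUnion : ν (⋃ i, A i) = 1
  measure_inter : ∀ i j, i ≠ j → ν (A i ∩ A j) = 0

/-- `H_ν(α) = - ∑_{A ∈ α} ν(A) log ν(A)`. -/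
def partitionEntropy (ν : Measure X) {ι : Type} [Fintype ι] (A : ι → Set X) : ℝ :=
  ∑ i, Real.negMulLog (ν.real (A i))

/-- The joined family `α ∨ f⁻¹ α ∨ ⋯ ∨ f^{-(n-1)} α`; its members are indexed by words `w` of
length `n`. -/
def iteratedJoin {k : ℕ} (f : X → X) (A : Fin k → Set X) (n : ℕ) (w : Fin n → Fin k) : Set X :=
  ⋂ i : Fin n, f^[(i : ℕ)] ⁻¹' A (w i)

/-- `h_ν(f, α) = inf_{n ≥ 1} (1/n) H_ν(α ∨ f⁻¹ α ∨ ⋯ ∨ f^{-(n-1)} α)`. For an `f`-invariant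
probability measure `ν` and a `ν`-partition `α`, this is also the limit as `n → ∞`. -/
def entropyOfPartition (ν : Measure X) (f : X → X) {k : ℕ} (A : Fin k → Set X) : EReal :=
  ⨅ n : ℕ, ((partitionEntropy ν (iteratedJoin f A (n + 1)) / ((n : ℝ) + 1) : ℝ) : EReal)

/-- The measure-theoretic (Kolmogorov–Sinai) entropy `h_ν(f)`: the supremum of `h_ν(f, α)` over all
finite `ν`-partitions `α`. -/
def measureEntropy (ν : Measure X) (f : X → X) : EReal :=
  ⨆ (k : ℕ) (A : Fin k → Set X) (_ : IsMeasurePartition ν A), entropyOfPartition ν f A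

end MeasureEntropy

section ContinuousMaps

variable {X : Type u} [TopologicalSpace X]

/-- Topological entropy of a self-map of a compact Hausdorff space, computed with the unique
uniform structure that is compatible with the topology. -/
def topEntropy [CompactSpace X] [T2Space X] (f : X → X) : EReal :=
  @Dynamics.coverEntropy X uniformSpaceOfCompactR1 f Set.univ

/-- The regular Borel probability measures that are invariant by `f`. -/
def invariantMeasures [MeasurableSpace X] (f : X → X) : Set (Measure X) :=
  {ν | IsProbabilityMeasure ν ∧ ν.Regular ∧ MeasurePreserving f ν ν}

/-- The entropy `h_μ(f)` of a functional `μ` on `C(X, ℝ)`: the supremum of `h_ν(f)` over all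
`f`-invariant regular Borel probability measures `ν ≤ μ`. -/
def entropy [MeasurableSpace X] (f : X → X) (μ : C(X, ℝ) → ℝ) : EReal :=
  ⨆ ν ∈ {ν ∈ invariantMeasures f | ofMeasure ν ≤ μ}, measureEntropy ν f

end ContinuousMaps

/-! ### Continuous open-dense defined maps -/

/-- A continuous open-dense defined map `X ⇢ Y`: a continuous map on an open dense subset `dom`
of `X`. The values of `toFun` outside `dom` play no role. -/
structure OpenDenseMap (X : Type u) (Y : Type v) [TopologicalSpace X] [TopologicalSpace Y] where
  dom : Set X
  toFun : X → Y
  isOpen_dom : IsOpen dom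
  dense_dom : Dense dom
  continuousOn_toFun : ContinuousOn toFun dom

namespace OpenDenseMap

section General

variable {X : Type u} {Y : Type v} [TopologicalSpace X] [TopologicalSpace Y]

/-- `OpenDom(f)`: the largest open set to which `f` extends continuously. -/
def openDom (f : OpenDenseMap X Y) : Set X :=
  ⋃₀ {V | IsOpen V ∧ ∃ g : X → Y, ContinuousOn g V ∧ EqOn g f.toFun (V ∩ f.dom)}

/-- The continuous extension of `f` to `OpenDom(f)` (with irrelevant values elsewhere): the value at
`x` is the limit of `f y` as `y → x` in `dom`. -/
def ext (f : OpenDenseMap X Y) : X → Y :=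
  extendFrom f.dom f.toFun

open Classical in
/-- The upper semicontinuous extension `E(g)` of a function `g` on `U`: it is `g` on `U`, and
`limsup_{y ∈ U, y → x} g(y)` at the points `x` outside `U`. -/
def uscExtension (U : Set X) (g : X → ℝ) (x : X) : ℝ :=
  if x ∈ U then g x else limsup g (𝓝[U] x)

/-- The pullback `f^* φ` of a continuous function: the upper semicontinuous extension of `φ ∘ f`
from `OpenDom(f)` to `X`. -/
def pullback (f : OpenDenseMap X Y) (φ : C(Y, ℝ)) : X → ℝ :=
  uscExtension f.openDom (fun x => φ (f.ext x))

/-- The pushforward `(f_* μ)(φ) = inf {μ(ψ) : ψ ∈ C(X, ℝ), ψ ≥ f^* φ}`. -/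
def push (f : OpenDenseMap X Y) (μ : C(X, ℝ) → ℝ) : C(Y, ℝ) → ℝ :=
  fun φ => sInf (μ '' {ψ : C(X, ℝ) | ∀ x, f.pullback φ x ≤ ψ x})

end General

section SelfMaps

variable {X : Type u} [TopologicalSpace X]

/-- `Ω_{f,∞}`: the points all of whose iterates `f^n(x)`, `n ≥ 0`, lie in `OpenDom(f)`. -/
def Omega (f : OpenDenseMap X X) : Set X :=
  {x | ∀ n : ℕ, f.ext^[n] x ∈ f.openDom}

/-- `f` is good with respect to iterates: `Ω_{f,∞}` is dense and its complement is nowhere dense. -/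
def IsGood (f : OpenDenseMap X X) : Prop :=
  Dense f.Omega ∧ IsNowhereDense (f.Omega)ᶜ

/-- `Γ_{f,∞}`: the closure in `X^ℕ` of the set of orbits `(x, f(x), f²(x), …)`, `x ∈ Ω_{f,∞}`. -/
def infinityGraph (f : OpenDenseMap X X) : Set (ℕ → X) :=
  closure ((fun x n => f.ext^[n] x) '' f.Omega)

instance [CompactSpace X] (f : OpenDenseMap X X) : CompactSpace f.infinityGraph :=
  isCompact_iff_compactSpace.1 isClosed_closure.isCompact

theorem shift_mapsTo (f : OpenDenseMap X X) :
    MapsTo (fun (s : ℕ → X) n => s (n + 1)) f.infinityGraph f.infinityGraph := by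
  refine MapsTo.closure ?_ (by fun_prop)
  rintro _ ⟨x, hx, rfl⟩
  refine ⟨f.ext x, fun n => ?_, ?_⟩
  · rw [← Function.iterate_succ_apply]
    exact hx (n + 1)
  · funext n
    exact (Function.iterate_succ_apply _ n x).symm

/-- The shift map `(x₁, x₂, x₃, …) ↦ (x₂, x₃, …)` on `Γ_{f,∞}`. -/
def shift (f : OpenDenseMap X X) : C(f.infinityGraph, f.infinityGraph) where
  toFun := f.shift_mapsTo.restrict
  continuous_toFun := (Continuous.continuousOn (by fun_prop)).mapsToRestrict f.shift_mapsTo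

/-- The projection `(x₁, x₂, x₃, …) ↦ x₁` from `Γ_{f,∞}` to `X`. -/
def proj (f : OpenDenseMap X X) : C(f.infinityGraph, X) where
  toFun s := s.1 0
  continuous_toFun := (continuous_apply 0).comp continuous_subtype_val

/-- The topological entropy of `f`: that of the shift map on `Γ_{f,∞}`. -/
def topEntropy [CompactSpace X] [T2Space X] (f : OpenDenseMap X X) : EReal :=
  Submeasure.topEntropy f.shift

/-- The entropy `h_μ(f)`: the supremum of the entropies of the shift map on `Γ_{f,∞}` with respect
to its invariant probability measures `ν` such that `(π₁)_* ν ≤ μ`. -/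
def entropy [MeasurableSpace X] (f : OpenDenseMap X X) (μ : C(X, ℝ) → ℝ) : EReal :=
  ⨆ ν ∈ {ν ∈ invariantMeasures f.shift | pushforward f.proj (ofMeasure ν) ≤ μ},
    measureEntropy ν f.shift

end SelfMaps

end OpenDenseMap

end

end Submeasure

/-!
The theorem rests on the variational principle for continuous self-maps `f` of a compact Hausdorff
space, `sup_ν h_ν(f) = h_top(f)` over the invariant regular Borel probability measures
(`iSup_measureEntropy_eq_topEntropy`). Both inequalities follow Misiurewicz, with all entropy
estimates carried out for random variables on finite weighted sample spaces, where subadditivity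
(`shannon_prod_le`, `shannon_pi_le`) and concavity (`sum_negMulLog_le_card_mul`) suffice.

* `h_ν(f) ≤ h_top(f)`: the atoms of the `m`-block partition are approximated from inside by disjoint
  compact sets. A dynamical ball for a fine entourage meets at most one of these sets at each time,
  so the good parts of the itineraries of `n` blocks contribute at most `log (cov · 2ⁿ)`, with `cov`
  the size of a dynamical cover, and the bad parts at most `2n`, to the entropy
  (`exists_entourage_partitionEntropy_le`). The error is linear in `n` while the orbits have length
  `mn`, so it disappears as `m → ∞`; this replaces the usual passage to the iterates of `f`.
* `h_top(f) ≤ sup_ν h_ν(f)`: empirical averages over large dynamical nets converge along an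
  ultrafilter, and the limit is an invariant regular measure by the Riesz–Markov–Kakutani theorem
  (`exists_invariant_tendsto_orbitAvg`). No metrizability is needed. Level sets of Urysohn functions
  give a partition into small pieces with null boundaries (`exists_label_null_boundary`), for which
  the frequencies of blocks converge, and the estimate `mul_log_card_le` passes to the limit.

Every invariant probability measure is below the supremum of all of them, so this supremum has full
entropy `h_top(f)`. For an open-dense defined map, the shift on `Γ_{f,∞}` is a continuous map of a
compact space, and any functional above `(π₁)_* ρ`, with `ρ` the supremum of the shift-invariant
measures, has full entropy. The smallest invariant one comes from the Knaster–Tarski argument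
(`exists_isLeast_fixedPoint`), because positive strong submeasures are closed under bounded suprema,
`f_*` is monotone, `f_*(max) ≤ max`, and `(π₁)_* ρ ≤ f_*((π₁)_* ρ)` (`le_push_pushforward_proj`).
-/

open scoped Uniformity

namespace Submeasure

noncomputable section

/-! ### Shannon entropy of finite-valued random variables -/

section Shannon

variable {Ω κ κ' : Type*} [Fintype Ω]

open Classical in
/-- The law of `Y` when the finite sample space `Ω` carries the weights `p`. -/
def law (p : Ω → ℝ) (Y : Ω → κ) (j : κ) : ℝ :=
  ∑ ω with Y ω = j, p ω

variable {p : Ω → ℝ}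

lemma law_nonneg (hp : ∀ ω, 0 ≤ p ω) (Y : Ω → κ) (j : κ) : 0 ≤ law p Y j :=
  Finset.sum_nonneg fun _ _ => hp _

/-- If the weights are the law of a map `D : X → Ω` for a measure `ν`, then the law of `Y` is that
of `Y ∘ D`. -/
lemma law_measureReal {X : Type*} [MeasurableSpace X] (ν : Measure X) [IsFiniteMeasure ν]
    (D : X → Ω) (hD : ∀ ω, MeasurableSet (D ⁻¹' {ω})) (Y : Ω → κ) (j : κ) :
    law (fun ω => ν.real (D ⁻¹' {ω})) Y j = ν.real ((fun x => Y (D x)) ⁻¹' {j}) := by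
  classical
  unfold law
  rw [← measureReal_biUnion_finset]
  · congr 1
    ext x
    simp
  · intro a _ b _ hab
    exact Disjoint.preimage _ (by simpa using hab)
  · exact fun ω _ => hD ω

lemma sum_measureReal_fiber {X : Type*} [MeasurableSpace X] (ν : Measure X) [IsProbabilityMeasure ν]
    (D : X → Ω) (hD : ∀ ω, MeasurableSet (D ⁻¹' {ω})) : ∑ ω, ν.real (D ⁻¹' {ω}) = 1 := by
  have := law_measureReal ν D hD (fun _ => ()) ()
  simpa [law] using this

variable [Fintype κ]

lemma sum_law (hp1 : ∑ ω, p ω = 1) (Y : Ω → κ) : ∑ j, law p Y j = 1 := by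
  classical
  rw [← hp1]
  unfold law
  convert Finset.sum_fiberwise Finset.univ Y p

/-- Marginals of a joint law. -/
lemma law_comp (Y : Ω → κ) (g : κ → κ') (j : κ') :
    law p (fun ω => g (Y ω)) j = law (law p Y) g j := by
  classical
  unfold law
  rw [← Finset.sum_fiberwise_of_maps_to (g := Y) (t := Finset.univ.filter fun i => g i = j)
    (by simp)]
  refine Finset.sum_congr (by ext; simp) fun i hi => Finset.sum_congr ?_ fun _ _ => rfl
  ext ω
  simp only [Finset.mem_filter, Finset.mem_univ, true_and] at hi ⊢
  constructor
  · rintro ⟨_, h⟩; exact h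
  · rintro rfl; exact ⟨hi, rfl⟩

/-- The Shannon entropy (in nats) of the random variable `Y` on the finite weighted space
`(Ω, p)`. -/
def shannon (p : Ω → ℝ) (Y : Ω → κ) : ℝ :=
  ∑ j, Real.negMulLog (law p Y j)

variable [Fintype κ']

lemma shannon_comp (Y : Ω → κ) (g : κ → κ') :
    shannon p (fun ω => g (Y ω)) = shannon (law p Y) g := by
  simp only [shannon, law_comp]

/-- `η(∑ pᵢ) ≤ ∑ η(pᵢ)` for `η(x) = -x log x` and `pᵢ ≥ 0`. -/
lemma negMulLog_sum_le {ι : Type*} (s : Finset ι) (q : ι → ℝ) (hq : ∀ i ∈ s, 0 ≤ q i) :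
    Real.negMulLog (∑ i ∈ s, q i) ≤ ∑ i ∈ s, Real.negMulLog (q i) := by
  rw [Real.negMulLog, neg_mul, Finset.sum_mul, ← Finset.sum_neg_distrib]
  refine Finset.sum_le_sum fun i hi => ?_
  rcases (hq i hi).eq_or_lt with h | h
  · simp [← h]
  · rw [Real.negMulLog]
    have := Real.log_le_log h (Finset.single_le_sum hq hi)
    nlinarith

lemma shannon_le_sum_negMulLog (hp : ∀ ω, 0 ≤ p ω) (Y : Ω → κ) :
    shannon p Y ≤ ∑ ω, Real.negMulLog (p ω) := by
  classical
  have := Finset.sum_fiberwise Finset.univ Y fun ω => Real.negMulLog (p ω)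
  rw [← this]
  refine Finset.sum_le_sum fun j _ => ?_
  unfold law
  convert negMulLog_sum_le _ _ fun ω _ => hp ω

lemma shannon_comp_le (hp : ∀ ω, 0 ≤ p ω) (Y : Ω → κ) (g : κ → κ') :
    shannon p (fun ω => g (Y ω)) ≤ shannon p Y := by
  rw [shannon_comp]
  exact shannon_le_sum_negMulLog (law_nonneg hp Y) g

/-- A random variable that is determined by `Z` has at most the entropy of `Z`. -/
lemma shannon_le_of_determined (hp : ∀ ω, 0 ≤ p ω) (Y : Ω → κ) (Z : Ω → κ')
    (h : ∀ ω ω', Z ω = Z ω' → Y ω = Y ω') : shannon p Y ≤ shannon p Z := by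
  classical
  rcases isEmpty_or_nonempty Ω with hΩ | ⟨⟨ω₀⟩⟩
  · simp [shannon, law]
  · obtain ⟨g, rfl⟩ : ∃ g : κ' → κ, Y = fun ω => g (Z ω) := by
      refine ⟨fun z => if hz : ∃ ω, Z ω = z then Y hz.choose else Y ω₀, funext fun ω => ?_⟩
      have hz : ∃ ω', Z ω' = Z ω := ⟨ω, rfl⟩
      simp only [dif_pos hz]
      exact h _ _ hz.choose_spec.symm
    exact shannon_comp_le hp Z g

/-- Gibbs' inequality, in the form that yields both subadditivity of the entropy and its bound by
the logarithm of the number of values. -/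
lemma negMulLog_add_mul_log_le {x y : ℝ} (hx : 0 ≤ x) (hy : 0 ≤ y) (hxy : 0 < x → 0 < y) :
    Real.negMulLog x + x * Real.log y ≤ y - x := by
  rcases hx.eq_or_lt with rfl | hx
  · rw [Real.negMulLog_zero, zero_mul, add_zero, sub_zero]; exact hy
  · have hy' := hxy hx
    have := Real.log_le_sub_one_of_pos (div_pos hy' hx)
    rw [Real.log_div hy'.ne' hx.ne'] at this
    have h2 := mul_le_mul_of_nonneg_left this hx.le
    rw [mul_sub, mul_sub, mul_div_cancel₀ _ hx.ne'] at h2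
    rw [Real.negMulLog]
    linarith

lemma shannon_prod_le (hp : ∀ ω, 0 ≤ p ω) (hp1 : ∑ ω, p ω = 1) (Y : Ω → κ) (Z : Ω → κ') :
    shannon p (fun ω => (Y ω, Z ω)) ≤ shannon p Y + shannon p Z := by
  classical
  set r : κ × κ' → ℝ := law p (fun ω => (Y ω, Z ω)) with hr
  have hr0 : ∀ a, 0 ≤ r a := law_nonneg hp _
  have hr1 : ∑ i, ∑ j, r (i, j) = 1 := by rw [← Fintype.sum_prod_type, hr, sum_law hp1]
  have hY : ∀ i, law p Y i = ∑ j, r (i, j) := fun i => by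
    have := law_comp (p := p) (fun ω => (Y ω, Z ω)) Prod.fst i
    simp only at this
    rw [this, law, Finset.sum_filter, Fintype.sum_prod_type]
    rw [Finset.sum_eq_single i (fun b _ hb => by simp [hb]) (by simp)]
    simp [hr]
  have hZ : ∀ j, law p Z j = ∑ i, r (i, j) := fun j => by
    have := law_comp (p := p) (fun ω => (Y ω, Z ω)) Prod.snd j
    simp only at this
    rw [this, law, Finset.sum_filter, Fintype.sum_prod_type]
    refine Finset.sum_congr rfl fun i _ => ?_
    rw [Finset.sum_eq_single j (fun b _ hb => by simp [hb]) (by simp)]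
    simp [hr]
  have hle1 : ∀ i j, r (i, j) ≤ law p Y i := fun i j => by
    rw [hY]
    exact Finset.single_le_sum (f := fun j => r (i, j)) (fun _ _ => hr0 _) (Finset.mem_univ j)
  have hle2 : ∀ i j, r (i, j) ≤ law p Z j := fun i j => by
    rw [hZ]
    exact Finset.single_le_sum (f := fun i => r (i, j)) (fun _ _ => hr0 _) (Finset.mem_univ i)
  have key : ∀ i j, Real.negMulLog (r (i, j)) + (r (i, j) * Real.log (law p Y i) +
      r (i, j) * Real.log (law p Z j)) ≤ law p Y i * law p Z j - r (i, j) := fun i j => by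
    have h := negMulLog_add_mul_log_le (hr0 (i, j))
      (mul_nonneg (law_nonneg hp Y i) (law_nonneg hp Z j))
      (fun h => mul_pos (h.trans_le (hle1 i j)) (h.trans_le (hle2 i j)))
    rcases (hr0 (i, j)).eq_or_lt with h0 | h0
    -- For `r (i, j) = 0` the logarithms of the marginals may be junk values, with coefficient `0`.
    · simpa [← h0] using h
    · rwa [Real.log_mul (h0.trans_le (hle1 i j)).ne' (h0.trans_le (hle2 i j)).ne', mul_add] at h
  have hsum := Finset.sum_le_sum fun i (_ : i ∈ Finset.univ) =>
    Finset.sum_le_sum fun j (_ : j ∈ Finset.univ) => key i j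
  simp only [Finset.sum_add_distrib, Finset.sum_sub_distrib, ← Finset.mul_sum, ← Finset.sum_mul,
    sum_law hp1, ← hY] at hsum
  rw [Finset.sum_comm (f := fun i j => r (i, j) * Real.log (law p Z j))] at hsum
  simp only [← Finset.sum_mul, ← hZ] at hsum
  have e1 : shannon p (fun ω => (Y ω, Z ω)) = ∑ i, ∑ j, Real.negMulLog (r (i, j)) := by
    rw [shannon, Fintype.sum_prod_type]
  have e2 : shannon p Y = - ∑ i, law p Y i * Real.log (law p Y i) := by
    simp [shannon, Real.negMulLog]
  have e3 : shannon p Z = - ∑ i, law p Z i * Real.log (law p Z i) := by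
    simp [shannon, Real.negMulLog]
  linarith

/-- The entropy is at most `log #T` if all values that are taken with positive weight lie in `T`. -/
lemma shannon_le_log_card (hp : ∀ ω, 0 ≤ p ω) (hp1 : ∑ ω, p ω = 1) (Y : Ω → κ) (T : Finset κ)
    (hT : ∀ j ∉ T, law p Y j = 0) : shannon p Y ≤ Real.log T.card := by
  have h1 : ∑ j ∈ T, law p Y j = 1 := by
    rw [← sum_law hp1 Y]
    exact Finset.sum_subset (Finset.subset_univ T) fun j _ hj => hT j hj
  have hpos : 0 < (T.card : ℝ) := by
    rcases T.eq_empty_or_nonempty with rfl | h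
    · simp at h1
    · exact_mod_cast h.card_pos
  have h2 : shannon p Y = ∑ j ∈ T, Real.negMulLog (law p Y j) :=
    (Finset.sum_subset (Finset.subset_univ T) fun j _ hj => by rw [hT j hj]; simp).symm
  have h3 := Finset.sum_le_sum fun j (_ : j ∈ T) =>
    negMulLog_add_mul_log_le (law_nonneg hp Y j) (inv_nonneg.2 hpos.le) fun _ => inv_pos.2 hpos
  simp only [Finset.sum_add_distrib, Finset.sum_sub_distrib, ← Finset.sum_mul, h1, ← h2,
    Finset.sum_const, nsmul_eq_mul, mul_inv_cancel₀ hpos.ne', Real.log_inv] at h3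
  linarith

lemma shannon_le_log_card_univ (hp : ∀ ω, 0 ≤ p ω) (hp1 : ∑ ω, p ω = 1) (Y : Ω → κ) :
    shannon p Y ≤ Real.log (Fintype.card κ) :=
  shannon_le_log_card hp hp1 Y Finset.univ (by simp)

/-- Subadditivity for a finite family of random variables. -/
lemma shannon_pi_le {ι : Type*} [DecidableEq ι] (hp : ∀ ω, 0 ≤ p ω) (hp1 : ∑ ω, p ω = 1)
    (Y : ι → Ω → κ) (S : Finset ι) :
    shannon p (fun ω (s : S) => Y s ω) ≤ ∑ s ∈ S, shannon p (Y s) := by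
  induction S using Finset.induction_on with
  | empty =>
    refine (shannon_le_log_card_univ hp hp1 _).trans ?_
    simp
  | insert a S ha ih =>
    rw [Finset.sum_insert ha]
    refine (shannon_le_of_determined hp _ (fun ω => (Y a ω, fun s : S => Y s ω)) ?_).trans
      ((shannon_prod_le hp hp1 _ _).trans (by gcongr))
    intro ω ω' h
    obtain ⟨h1, h2⟩ := Prod.ext_iff.1 h
    funext ⟨s, hs⟩
    rcases Finset.mem_insert.1 hs with rfl | hs
    · exact h1
    · exact congrFun h2 ⟨s, hs⟩

/-- The uniform law on `Ω` maximizes the entropy: an injective random variable has entropy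
`log #Ω`. -/
lemma log_card_le_shannon_of_injective [Nonempty Ω] (Y : Ω → κ) (hY : Function.Injective Y) :
    Real.log (Fintype.card Ω) ≤ shannon (fun _ : Ω => (Fintype.card Ω : ℝ)⁻¹) Y := by
  classical
  have hpos : 0 < (Fintype.card Ω : ℝ) := by exact_mod_cast Fintype.card_pos
  refine le_trans ?_ (shannon_le_of_determined (fun _ => inv_nonneg.2 hpos.le) (fun ω => ω) Y
    fun ω ω' h => hY h)
  have hlaw : ∀ j : Ω, law (fun _ : Ω => (Fintype.card Ω : ℝ)⁻¹) (fun ω => ω) j =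
      (Fintype.card Ω : ℝ)⁻¹ := fun j => by
    rw [law, Finset.sum_filter, Finset.sum_eq_single j (fun b _ hb => if_neg hb) (by simp),
      if_pos rfl]
  simp only [shannon, hlaw, Finset.sum_const, Finset.card_univ, nsmul_eq_mul, Real.negMulLog,
    Real.log_inv, neg_mul_neg]
  rw [mul_inv_cancel_left₀ hpos.ne']

/-- Concavity: the average of the entropies is at most the entropy of the average law. -/
lemma sum_negMulLog_le_card_mul {ι : Type*} {n : ℕ} (hn : 0 < n) (r : ℕ → ι → ℝ) [Fintype ι]
    (hr : ∀ i j, 0 ≤ r i j) :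
    ∑ i ∈ Finset.range n, ∑ j, Real.negMulLog (r i j) ≤
      n * ∑ j, Real.negMulLog ((n : ℝ)⁻¹ * ∑ i ∈ Finset.range n, r i j) := by
  have hn' : (0 : ℝ) < n := by exact_mod_cast hn
  rw [Finset.sum_comm, Finset.mul_sum]
  refine Finset.sum_le_sum fun j _ => ?_
  have := Real.concaveOn_negMulLog.le_map_sum (t := Finset.range n) (w := fun _ => (n : ℝ)⁻¹)
    (p := fun i => r i j) (fun _ _ => inv_nonneg.2 hn'.le) (by simp [hn'.ne'])
    (fun i _ => hr i j)
  simp only [smul_eq_mul, ← Finset.mul_sum] at this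
  rwa [inv_mul_le_iff₀ hn'] at this

end Shannon

/-! ### Partitions as labellings -/

section Labels

variable {X : Type*}

/-- The word formed by the labels of the first `n` points of the orbit of `x`. -/
def itinerary {κ : Type*} (f : X → X) (a : X → κ) (n : ℕ) (x : X) : Fin n → κ :=
  fun i => a (f^[(i : ℕ)] x)

lemma iteratedJoin_fiber {k : ℕ} (f : X → X) (a : X → Fin k) (n : ℕ) (w : Fin n → Fin k) :
    iteratedJoin f (fun i => a ⁻¹' {i}) n w = itinerary f a n ⁻¹' {w} := by
  ext x
  simp [iteratedJoin, itinerary, funext_iff]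

variable [MeasurableSpace X]

lemma measurableSet_itinerary_fiber {κ : Type*} {f : X → X} (hf : Measurable f) {a : X → κ}
    (ha : ∀ i, MeasurableSet (a ⁻¹' {i})) (n : ℕ) (w : Fin n → κ) :
    MeasurableSet (itinerary f a n ⁻¹' {w}) := by
  have : itinerary f a n ⁻¹' {w} = ⋂ i : Fin n, f^[(i : ℕ)] ⁻¹' (a ⁻¹' {w i}) := by
    ext x
    simp [itinerary, funext_iff]
  rw [this]
  exact MeasurableSet.iInter fun i => hf.iterate i (ha _)

/-- Every finite partition modulo null sets agrees almost everywhere with the fibers of a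
labelling: the label of a point is the first index of a member that contains it. -/
lemma IsMeasurePartition.exists_label {ν : Measure X} [IsProbabilityMeasure ν] {k : ℕ}
    {A : Fin k → Set X} (hA : IsMeasurePartition ν A) :
    ∃ a : X → Fin k, (∀ i, MeasurableSet (a ⁻¹' {i})) ∧ ∀ i, A i =ᵐ[ν] a ⁻¹' {i} := by
  classical
  have hk : Nonempty (Fin k) := by
    by_contra h
    rw [not_nonempty_iff] at h
    have := hA.measure_iUnion
    simp at this
  obtain ⟨i₀⟩ := hk
  have hfirst : ∀ x, ∃ i : Fin k, (x ∈ A i ∧ ∀ j < i, x ∉ A j) ∨ (x ∉ ⋃ i, A i) ∧ i = i₀ := by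
    intro x
    by_cases hx : x ∈ ⋃ i, A i
    · have hne : {i | x ∈ A i}.Nonempty := mem_iUnion.1 hx
      have hwf : WellFounded (fun i j : Fin k => i < j) := wellFounded_lt
      exact ⟨hwf.min _ hne, Or.inl ⟨hwf.min_mem _ hne, fun j hj hxj => hwf.not_lt_min _ hxj hj⟩⟩
    · exact ⟨i₀, Or.inr ⟨hx, rfl⟩⟩
  choose a ha using hfirst
  refine ⟨a, fun i => ?_, fun i => ?_⟩
  · have : a ⁻¹' {i} = (A i \ ⋃ j : Fin k, ⋃ _ : j < i, A j) ∪
        ((⋃ i, A i)ᶜ ∩ {_x | i = i₀}) := by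
      ext x
      simp only [mem_preimage, mem_singleton_iff, mem_union, Set.mem_sdiff, mem_iUnion, exists_prop,
        not_exists, not_and, mem_inter_iff, mem_compl_iff, mem_ofPred_eq]
      constructor
      · rintro rfl
        rcases ha x with h | h
        · exact Or.inl h
        · exact Or.inr ⟨by simpa using h.1, h.2⟩
      · rintro (h | h)
        · rcases ha x with h' | h'
          · by_contra hne
            rcases lt_or_gt_of_ne hne with hlt | hlt
            · exact h.2 _ hlt h'.1
            · exact h'.2 _ hlt h.1
          · exact absurd (mem_iUnion.2 ⟨i, h.1⟩) h'.1
        · rcases ha x with h' | h'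
          · exact absurd h'.1 (h.1 _)
          · exact h'.2.trans h.2.symm
    rw [this]
    refine ((hA.measurableSet i).diff ?_).union ((MeasurableSet.iUnion hA.measurableSet).compl.inter
      (MeasurableSet.const _))
    exact MeasurableSet.iUnion fun j => MeasurableSet.iUnion fun _ => hA.measurableSet j
  · have h1 : ∀ᵐ x ∂ν, x ∈ ⋃ i, A i :=
      (prob_compl_eq_zero_iff (MeasurableSet.iUnion hA.measurableSet)).2 hA.measure_iUnion
    have h2 : ∀ᵐ x ∂ν, ∀ i j, i ≠ j → x ∉ A i ∩ A j := by
      simp only [ae_all_iff]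
      exact fun i j hij => measure_eq_zero_iff_ae_notMem.1 (hA.measure_inter i j hij)
    filter_upwards [h1, h2] with x hx1 hx2
    rcases ha x with h | h
    · refine propext ⟨fun hx => ?_, fun hx => ?_⟩
      · by_contra hne
        exact hx2 _ _ hne ⟨h.1, hx⟩
      · have : a x = i := hx
        exact this ▸ h.1
    · exact absurd hx1 h.1

lemma entropyOfPartition_congr {ν : Measure X} {f : X → X} (hf : MeasurePreserving f ν ν) {k : ℕ}
    {A B : Fin k → Set X} (h : ∀ i, A i =ᵐ[ν] B i) :
    entropyOfPartition ν f A = entropyOfPartition ν f B := by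
  unfold entropyOfPartition partitionEntropy
  have : ∀ n w, ν.real (iteratedJoin f A n w) = ν.real (iteratedJoin f B n w) := fun n w =>
    measureReal_congr <| Filter.EventuallyEq.countable_iInter fun i =>
      (hf.iterate i).quasiMeasurePreserving.preimage_ae_eq (h _)
  simp only [this]

end Labels

/-! ### Measure-theoretic entropy is at most topological entropy -/

section UpperBound

/-- The label of a point that lies in the distinguished part of its atom, if it does. -/
def goodLabel {G : Type*} : G × Bool → Option G
  | (γ, true) => some γ
  | (_, false) => none

/-- The label of a point that does not lie in the distinguished part of its atom. -/
def badLabel {G : Type*} : G × Bool → Option G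
  | (_, true) => none
  | (γ, false) => some γ

lemma eq_of_goodLabel_badLabel {G : Type*} {p q : G × Bool} (h : goodLabel p = goodLabel q)
    (h' : badLabel p = badLabel q) : p = q := by
  rcases p with ⟨γ, _ | _⟩ <;> rcases q with ⟨γ', _ | _⟩ <;> simp_all [goodLabel, badLabel]

variable {X : Type*} [UniformSpace X] [CompactSpace X]

lemma exists_entourage_of_disjoint_compacts [T2Space X] {ι : Type*} [Finite ι] (B : ι → Set X)
    (hB : ∀ i, IsCompact (B i)) (hd : Pairwise fun i j => Disjoint (B i) (B j)) :
    ∃ U ∈ 𝓤 X, ∀ x x' y i j, (x, y) ∈ U → (x', y) ∈ U → x ∈ B i → x' ∈ B j →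
      i = j := by
  have hV : (⋃ i, ⋃ j, ⋃ _ : i ≠ j, B i ×ˢ B j)ᶜ ∈ 𝓤 X := by
    rw [← nhdsSet_diagonal_eq_uniformity]
    refine IsOpen.mem_nhdsSet (isOpen_compl_iff.2 ?_) |>.2 ?_
    · exact isClosed_iUnion_of_finite fun i => isClosed_iUnion_of_finite fun j =>
        isClosed_iUnion_of_finite fun _ => (hB i).isClosed.prod (hB j).isClosed
    · rintro ⟨x, y⟩ h
      obtain rfl : x = y := h
      simp only [mem_compl_iff, mem_iUnion, mem_prod, exists_prop, not_exists, not_and]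
      exact fun i j hij hi hj => (hd hij).le_bot ⟨hi, hj⟩
  obtain ⟨U, hU, hs, hUV⟩ := comp_symm_mem_uniformity_sets hV
  refine ⟨U, hU, fun x x' y i j hxy hxy' hx hx' => ?_⟩
  by_contra hij
  refine hUV (SetRel.prodMk_mem_comp hxy (hs.symm _ _ hxy')) ?_
  simp only [mem_iUnion, exists_prop]
  exact ⟨i, j, hij, hx, hx'⟩

variable [MeasurableSpace X] [BorelSpace X]

/-- The main estimate: for a fixed block length `m`, compact approximations from inside to the
atoms of the `m`-block partition give an entourage `U` such that the entropy of the `mn`-block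
partition is controlled by the size of a `(U, mn)`-cover, up to an error linear in `n` with a
constant that does not depend on `m`. -/
lemma exists_entourage_partitionEntropy_le [T2Space X] {f : X → X} (hf : Continuous f)
    {ν : Measure X} (hν : ν ∈ invariantMeasures f) {k : ℕ} {a : X → Fin k}
    (ha : ∀ i, MeasurableSet (a ⁻¹' {i})) {m : ℕ} (hm : 0 < m) :
    ∃ U ∈ 𝓤 X, ∀ (n : ℕ) (s : Finset X), Dynamics.IsDynCoverOf f univ U (m * n) s →
      partitionEntropy ν (iteratedJoin f (fun i => a ⁻¹' {i}) (m * n)) ≤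
        Real.log s.card + 3 * n := by
  classical
  obtain ⟨hprob, hreg, hinv⟩ := hν
  let G := Fin m → Fin k
  set g : X → G := itinerary f a m with hg
  have hgm : ∀ γ, MeasurableSet (g ⁻¹' {γ}) := measurableSet_itinerary_fiber hf.measurable ha m
  -- `δ` is so small that all atoms together contribute at most `1` to the entropy if each has
  -- measure less than `δ`.
  obtain ⟨δ, hδ, hδη⟩ : ∃ δ > 0, ∀ t : ℝ, 0 ≤ t → t < δ →
      Real.negMulLog t ≤ 1 / (Fintype.card G + 1 : ℝ) := by
    have h := Metric.continuous_iff.1 Real.continuous_negMulLog 0 (1 / (Fintype.card G + 1 : ℝ))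
      (by positivity)
    obtain ⟨δ, hδ, h⟩ := h
    refine ⟨δ, hδ, fun t ht htδ => ?_⟩
    have := h t (by rwa [Real.dist_0_eq_abs, abs_of_nonneg ht])
    rw [Real.negMulLog_zero, Real.dist_0_eq_abs] at this
    exact (le_abs_self _).trans this.le
  have hB : ∀ γ, ∃ K, K ⊆ g ⁻¹' {γ} ∧ IsCompact K ∧ ν (g ⁻¹' {γ} \ K) < ENNReal.ofReal δ :=
    fun γ => (hgm γ).exists_isCompact_sdiff_lt (measure_ne_top _ _) (by simpa using hδ)
  choose B hBg hBc hBδ using hB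
  obtain ⟨U, hU, hUB⟩ := exists_entourage_of_disjoint_compacts B hBc fun i j hij =>
    (Disjoint.preimage g (by simpa using hij)).mono (hBg i) (hBg j)
  refine ⟨U, hU, fun n s hs => ?_⟩
  -- Each point carries its `m`-block label and the information whether it lies in the compact part.
  let e : X → G × Bool := fun x => (g x, decide (x ∈ B (g x)))
  have he : ∀ c, MeasurableSet (e ⁻¹' {c}) := by
    rintro ⟨γ, _ | _⟩
    · have : e ⁻¹' {(γ, false)} = g ⁻¹' {γ} \ B γ := by
        ext x
        simp only [e, mem_preimage, mem_singleton_iff, Prod.mk.injEq, decide_eq_false_iff_not,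
          Set.mem_sdiff]
        constructor <;> rintro ⟨rfl, h⟩ <;> exact ⟨rfl, h⟩
      rw [this]
      exact (hgm γ).diff (hBc γ).measurableSet
    · have : e ⁻¹' {(γ, true)} = B γ := by
        ext x
        simp only [e, mem_preimage, mem_singleton_iff, Prod.mk.injEq, decide_eq_true_eq]
        constructor
        · rintro ⟨rfl, h⟩; exact h
        · intro h
          obtain rfl : g x = γ := hBg γ h
          exact ⟨rfl, h⟩
      rw [this]
      exact (hBc γ).measurableSet
  let D : X → (Fin n → G × Bool) := itinerary f^[m] e n
  have hD : ∀ ω, MeasurableSet (D ⁻¹' {ω}) :=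
    measurableSet_itinerary_fiber (hf.measurable.iterate m) he n
  let p : (Fin n → G × Bool) → ℝ := fun ω => ν.real (D ⁻¹' {ω})
  have hp : ∀ ω, 0 ≤ p ω := fun ω => measureReal_nonneg
  have hp1 : ∑ ω, p ω = 1 := sum_measureReal_fiber ν D hD
  let Y : (Fin n → G × Bool) → (Fin (m * n) → Fin k) := fun ω j =>
    (ω ⟨j / m, Nat.div_lt_of_lt_mul j.2⟩).1 ⟨j % m, Nat.mod_lt _ hm⟩
  have hY : partitionEntropy ν (iteratedJoin f (fun i => a ⁻¹' {i}) (m * n)) = shannon p Y := by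
    refine Finset.sum_congr rfl fun w _ => ?_
    rw [iteratedJoin_fiber, law_measureReal ν D hD]
    congr 3
    funext x j
    simp only [Y, D, e, g, itinerary]
    rw [← Function.iterate_mul, ← Function.iterate_add_apply, Nat.mod_add_div]
  have hsplit : shannon p Y ≤ shannon p (fun ω i => goodLabel (ω i)) +
      shannon p (fun ω i => badLabel (ω i)) := by
    refine (shannon_le_of_determined hp Y
      (fun ω => ((fun i => goodLabel (ω i)), fun i => badLabel (ω i))) ?_).trans
      (shannon_prod_le hp hp1 _ _)
    intro ω ω' h
    obtain ⟨h1, h2⟩ := Prod.ext_iff.1 h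
    rw [funext fun i => eq_of_goodLabel_badLabel (congrFun h1 i) (congrFun h2 i)]
  have hbad1 : ∀ i, shannon p (fun ω : Fin n → G × Bool => badLabel (ω i)) ≤ 2 := by
    intro i
    have hlaw : ∀ c, law p (fun ω : Fin n → G × Bool => badLabel (ω i)) c =
        ν.real ((fun x => badLabel (e x)) ⁻¹' {c}) := by
      intro c
      rw [law_measureReal ν D hD]
      have hc : MeasurableSet ((fun x => badLabel (e x)) ⁻¹' {c}) := by
        have : (fun x => badLabel (e x)) ⁻¹' {c} = ⋃ d ∈ badLabel ⁻¹' {c}, e ⁻¹' {d} := by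
          ext x; simp
        rw [this]
        exact MeasurableSet.biUnion (Set.to_countable _) fun d _ => he d
      rw [← ((hinv.iterate m).iterate i).measureReal_preimage hc.nullMeasurableSet]
      rfl
    have hsome : ∀ γ, (fun x => badLabel (e x)) ⁻¹' {some γ} = g ⁻¹' {γ} \ B γ := by
      intro γ
      ext x
      by_cases hx : x ∈ B (g x)
      · simp only [e, hx, decide_true, badLabel, mem_preimage, mem_singleton_iff, reduceCtorEq,
          Set.mem_sdiff, false_iff, not_and, not_not]
        rintro rfl; exact hx
      · simp only [e, hx, decide_false, badLabel, mem_preimage, mem_singleton_iff,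
          Option.some.injEq, Set.mem_sdiff]
        constructor
        · rintro rfl; exact ⟨rfl, hx⟩
        · exact fun h => h.1
    have hnone : Real.negMulLog (law p (fun ω : Fin n → G × Bool => badLabel (ω i)) none) ≤ 1 := by
      have h0 := law_nonneg hp (fun ω : Fin n → G × Bool => badLabel (ω i)) none
      have := negMulLog_add_mul_log_le h0 zero_le_one fun _ => zero_lt_one
      rw [Real.log_one, mul_zero, add_zero] at this
      linarith
    have hsum : ∑ γ : G, Real.negMulLog (law p (fun ω : Fin n → G × Bool => badLabel (ω i))
        (some γ)) ≤ ∑ γ : G, 1 / (Fintype.card G + 1 : ℝ) := by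
      refine Finset.sum_le_sum fun γ _ => ?_
      rw [hlaw, hsome]
      refine hδη _ measureReal_nonneg ?_
      exact (ENNReal.lt_ofReal_iff_toReal_lt (measure_ne_top _ _)).1 (hBδ γ)
    rw [shannon, Fintype.sum_option]
    have : ∑ γ : G, 1 / (Fintype.card G + 1 : ℝ) ≤ 1 := by
      rw [Finset.sum_const, Finset.card_univ, nsmul_eq_mul, mul_one_div, div_le_one (by positivity)]
      linarith
    linarith
  have hbad : shannon p (fun ω i => badLabel (ω i)) ≤ 2 * n := by
    refine (shannon_le_of_determined hp _
      (fun ω (i : (Finset.univ : Finset (Fin n))) => badLabel (ω i)) ?_).trans ?_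
    · intro ω ω' h
      funext i
      exact congrFun h ⟨i, Finset.mem_univ i⟩
    · refine (shannon_pi_le hp hp1 (fun i ω => badLabel (ω i)) Finset.univ).trans
        ((Finset.sum_le_sum fun i _ => hbad1 i).trans ?_)
      simp [mul_comm]
  -- In a dynamical ball at most two good labels occur at each time: `none` and one other.
  have hcenter : ∀ (y : X) (i : Fin n), ∃ c : Option G, ∀ x,
      (x, y) ∈ Dynamics.dynEntourage f U (m * n) →
        goodLabel (D x i) = none ∨ goodLabel (D x i) = c := by
    intro y i
    by_cases h : ∃ x, (x, y) ∈ Dynamics.dynEntourage f U (m * n) ∧ goodLabel (D x i) ≠ none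
    · obtain ⟨x, hxy, hx⟩ := h
      refine ⟨goodLabel (D x i), fun x' hxy' => ?_⟩
      by_cases hx' : goodLabel (D x' i) = none
      · exact Or.inl hx'
      · right
        have hmem : ∀ z, goodLabel (D z i) ≠ none → goodLabel (D z i) =
            some (g (f^[m * i] z)) ∧ f^[m * i] z ∈ B (g (f^[m * i] z)) := by
          intro z hz
          simp only [D, itinerary, ← Function.iterate_mul, e] at hz ⊢
          by_cases hzB : f^[m * i] z ∈ B (g (f^[m * i] z))
          · simp [hzB, goodLabel]
          · simp [hzB, goodLabel] at hz
        have hlt : m * (i : ℕ) < m * n := Nat.mul_lt_mul_of_pos_left i.2 hm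
        rw [(hmem x hx).1, (hmem x' hx').1]
        exact congrArg some (hUB _ _ _ _ _ (Dynamics.mem_dynEntourage.1 hxy' _ hlt)
          (Dynamics.mem_dynEntourage.1 hxy _ hlt) (hmem x' hx').2 (hmem x hx).2)
    · refine ⟨none, fun x hxy => ?_⟩
      by_contra hx
      exact h ⟨x, hxy, fun h' => hx (Or.inl h')⟩
  choose γ hγ using hcenter
  let T : Finset (Fin n → Option G) := (s ×ˢ (Finset.univ : Finset (Fin n → Bool))).image
    fun q i => if q.2 i then γ q.1 i else none
  have hT : T.card ≤ s.card * 2 ^ n := by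
    refine Finset.card_image_le.trans ?_
    simp [Finset.card_product]
  have hs0 : 0 < (s.card : ℝ) := by
    obtain ⟨x⟩ : Nonempty X := nonempty_of_isProbabilityMeasure ν
    obtain ⟨y, hy, -⟩ := hs (mem_univ x)
    exact_mod_cast Finset.card_pos.2 ⟨y, hy⟩
  have hlawT : ∀ w ∉ T, law p (fun ω i => goodLabel (ω i)) w = 0 := by
    intro w hw
    rw [law_measureReal ν D hD]
    suffices h : (fun x i => goodLabel (D x i)) ⁻¹' {w} = ∅ by rw [h, measureReal_empty]
    rw [eq_empty_iff_forall_notMem]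
    intro x hx
    obtain ⟨y, hy, hxy⟩ := hs (mem_univ x)
    refine hw (Finset.mem_image.2 ⟨(y, fun i => decide (goodLabel (D x i) = γ y i)),
      Finset.mem_product.2 ⟨hy, Finset.mem_univ _⟩, ?_⟩)
    rw [← (hx : (fun i => goodLabel (D x i)) = w)]
    funext i
    by_cases h : goodLabel (D x i) = γ y i
    · simp [h]
    · simp only [h, decide_false, Bool.false_eq_true, if_false]
      exact ((hγ y i x hxy).resolve_right h).symm
  have hgood : shannon p (fun ω i => goodLabel (ω i)) ≤ Real.log s.card + n := by
    have hT0 : 0 < T.card := by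
      rw [Finset.card_pos, Finset.image_nonempty, Finset.nonempty_product]
      exact ⟨Finset.card_pos.1 (by exact_mod_cast hs0), Finset.univ_nonempty⟩
    refine (shannon_le_log_card hp hp1 _ T hlawT).trans ?_
    calc Real.log T.card ≤ Real.log (s.card * 2 ^ n) :=
          Real.log_le_log (by exact_mod_cast hT0) (by exact_mod_cast hT)
      _ = Real.log s.card + n * Real.log 2 := by
          rw [Real.log_mul hs0.ne' (by positivity), Real.log_pow]
      _ ≤ Real.log s.card + n * 1 := by
          gcongr
          linarith [Real.log_two_lt_d9]
      _ = _ := by ring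
  rw [hY]
  linarith

/-- For a genuine partition, the bound follows by letting the block length tend to infinity. -/
theorem entropyOfPartition_le_coverEntropy [T2Space X] {f : X → X} (hf : Continuous f)
    {ν : Measure X} (hν : ν ∈ invariantMeasures f) {k : ℕ} {a : X → Fin k}
    (ha : ∀ i, MeasurableSet (a ⁻¹' {i})) :
    entropyOfPartition ν f (fun i => a ⁻¹' {i}) ≤ Dynamics.coverEntropy f univ := by
  refine EReal.le_of_forall_lt_iff_le.1 fun z hz => ?_
  obtain ⟨c, hc, hcz⟩ := EReal.lt_iff_exists_real_btwn.1 hz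
  have hcz : c < z := by exact_mod_cast hcz
  obtain ⟨m, hm⟩ := exists_nat_gt (3 / (z - c))
  have hm0 : (0 : ℝ) < m := (by have := sub_pos.2 hcz; positivity : 0 < 3 / (z - c)).trans hm
  have hm0' : 0 < m := by exact_mod_cast hm0
  rw [div_lt_iff₀ (sub_pos.2 hcz)] at hm
  obtain ⟨U, hU, hcov⟩ := exists_entourage_partitionEntropy_le hf hν ha hm0'
  have hlt : Dynamics.coverEntropyEntourage f univ U < c :=
    (Dynamics.coverEntropyEntourage_le_coverEntropy f univ hU).trans_lt hc
  have hev := eventually_lt_of_limsup_lt hlt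
  obtain ⟨N, hN⟩ := eventually_atTop.1 hev
  -- A length `m n ≥ N` at which the covering number is at most `exp (c m n)`.
  set n := N + 1 with hn
  have hn0 : (0 : ℝ) < n := by positivity
  have hmnN : N ≤ m * n := by nlinarith
  have h1 := hN _ hmnN
  have hmn : (0 : ℝ) < (m * n : ℕ) := by push_cast; positivity
  have hfin := Dynamics.coverMincard_finite_of_isCompact_uniformContinuous (T := f)
    (F := univ) isCompact_univ (CompactSpace.uniformContinuous_of_continuous hf) hU (m * n)
  obtain ⟨s, hs, hsc⟩ := (Dynamics.coverMincard_finite_iff f univ U (m * n)).1 hfin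
  have hH := hcov n s hs
  have hlog : Real.log s.card ≤ c * (m * n : ℕ) := by
    have := hν.1
    obtain ⟨x⟩ : Nonempty X := nonempty_of_isProbabilityMeasure ν
    obtain ⟨y, hy, -⟩ := hs (mem_univ x)
    have h0 : 0 < s.card := Finset.card_pos.2 ⟨y, hy⟩
    have e1 : ENNReal.log ((Dynamics.coverMincard f univ U (m * n) : ℕ∞) : ENNReal) =
        (Real.log s.card : ℝ) := by
      rw [← hsc, ← ENNReal.log_ofReal_of_pos (by exact_mod_cast h0)]
      simp
    rw [e1, EReal.div_lt_iff (by exact_mod_cast hmn) (EReal.natCast_ne_top _)] at h1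
    exact_mod_cast h1.le
  unfold entropyOfPartition
  refine (iInf_le _ (m * n - 1)).trans ?_
  have hmn1 : m * n - 1 + 1 = m * n := Nat.sub_add_cancel (Nat.mul_pos hm0' (by omega))
  have hmn2 : ((m * n - 1 : ℕ) : ℝ) + 1 = (m * n : ℕ) := by exact_mod_cast hmn1
  rw [hmn1, hmn2, EReal.coe_le_coe_iff, div_le_iff₀ hmn]
  push_cast at hlog ⊢
  nlinarith

/-- The entropy of an invariant regular probability measure is at most the topological entropy. -/
theorem measureEntropy_le_coverEntropy [T2Space X] {f : X → X} (hf : Continuous f)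
    {ν : Measure X} (hν : ν ∈ invariantMeasures f) :
    measureEntropy ν f ≤ Dynamics.coverEntropy f univ := by
  refine iSup_le fun k => iSup₂_le fun A hA => ?_
  have := hν.1
  obtain ⟨a, ha, hAa⟩ := hA.exists_label
  rw [entropyOfPartition_congr hν.2.2 hAa]
  exact entropyOfPartition_le_coverEntropy hf hν ha

end UpperBound

/-! ### Limits of empirical averages -/

section Averages

variable {X : Type*}

/-- The average of `φ` over the first `n` points of the orbits of the points of `E`. -/
def orbitAvg (f : X → X) (E : Finset X) (n : ℕ) (φ : X → ℝ) : ℝ :=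
  (n : ℝ)⁻¹ * ∑ i ∈ Finset.range n, (E.card : ℝ)⁻¹ * ∑ x ∈ E, φ (f^[i] x)

lemma orbitAvg_mono (f : X → X) (E : Finset X) (n : ℕ) {φ ψ : X → ℝ} (h : φ ≤ ψ) :
    orbitAvg f E n φ ≤ orbitAvg f E n ψ := by
  unfold orbitAvg
  gcongr
  exact h _

lemma orbitAvg_add (f : X → X) (E : Finset X) (n : ℕ) (φ ψ : X → ℝ) :
    orbitAvg f E n (φ + ψ) = orbitAvg f E n φ + orbitAvg f E n ψ := by
  simp only [orbitAvg, Pi.add_apply, Finset.sum_add_distrib, mul_add]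

lemma orbitAvg_smul (f : X → X) (E : Finset X) (n : ℕ) (c : ℝ) (φ : X → ℝ) :
    orbitAvg f E n (c • φ) = c * orbitAvg f E n φ := by
  simp only [orbitAvg, Pi.smul_apply, smul_eq_mul, Finset.mul_sum]
  exact Finset.sum_congr rfl fun _ _ => Finset.sum_congr rfl fun _ _ => by ring

lemma orbitAvg_sum {ι : Type*} (f : X → X) (E : Finset X) (n : ℕ) (s : Finset ι)
    (φ : ι → X → ℝ) :
    orbitAvg f E n (fun x => ∑ j ∈ s, φ j x) = ∑ j ∈ s, orbitAvg f E n (φ j) := by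
  classical
  induction s using Finset.induction_on with
  | empty => simp [orbitAvg]
  | insert a s ha ih =>
    rw [Finset.sum_insert ha, ← ih, ← orbitAvg_add]
    congr 1
    funext x
    simp [Finset.sum_insert ha]

lemma orbitAvg_const (f : X → X) {E : Finset X} (hE : E.Nonempty) {n : ℕ} (hn : 0 < n) (c : ℝ) :
    orbitAvg f E n (fun _ => c) = c := by
  have h1 : (E.card : ℝ) ≠ 0 := by exact_mod_cast hE.card_pos.ne'
  have h2 : (n : ℝ) ≠ 0 := by exact_mod_cast hn.ne'
  simp [orbitAvg, inv_mul_cancel_left₀ h1, inv_mul_cancel_left₀ h2]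

lemma abs_orbitAvg_le (f : X → X) (E : Finset X) (n : ℕ) {φ : X → ℝ} {C : ℝ} (hC : 0 ≤ C)
    (h : ∀ x, |φ x| ≤ C) : |orbitAvg f E n φ| ≤ C := by
  have hinner : ∀ i, |(E.card : ℝ)⁻¹ * ∑ x ∈ E, φ (f^[i] x)| ≤ C := by
    intro i
    rw [abs_mul, abs_of_nonneg (by positivity)]
    rcases E.eq_empty_or_nonempty with rfl | hE
    · simpa using hC
    · rw [inv_mul_le_iff₀ (by exact_mod_cast hE.card_pos), ← nsmul_eq_mul]
      exact (Finset.abs_sum_le_sum_abs _ _).trans (Finset.sum_le_card_nsmul _ _ _ fun _ _ => h _)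
  unfold orbitAvg
  rw [abs_mul, abs_of_nonneg (by positivity)]
  rcases Nat.eq_zero_or_pos n with rfl | hn
  · simpa using hC
  · rw [inv_mul_le_iff₀ (by exact_mod_cast hn), ← nsmul_eq_mul]
    refine (Finset.abs_sum_le_sum_abs _ _).trans
      ((Finset.sum_le_card_nsmul _ _ C fun i _ => hinner i).trans ?_)
    simp

/-- Averages along orbits of length `n` are invariant up to an error `O(1/n)`. -/
lemma abs_orbitAvg_comp_sub_le (f : X → X) (E : Finset X) (n : ℕ) {φ : X → ℝ} {C : ℝ}
    (hC : 0 ≤ C) (h : ∀ x, |φ x| ≤ C) :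
    |orbitAvg f E n (φ ∘ f) - orbitAvg f E n φ| ≤ (n : ℝ)⁻¹ * (2 * C) := by
  set A : ℕ → ℝ := fun i => (E.card : ℝ)⁻¹ * ∑ x ∈ E, φ (f^[i] x) with hA
  have hAC : ∀ i, |A i| ≤ C := by
    intro i
    have := abs_orbitAvg_le (fun x => x) E 1 (φ := fun x => φ (f^[i] x)) hC fun x => h _
    simpa [orbitAvg, hA, abs_mul] using this
  have h1 : orbitAvg f E n (φ ∘ f) = (n : ℝ)⁻¹ * ∑ i ∈ Finset.range n, A (i + 1) := by
    simp only [orbitAvg, hA, Function.comp_apply, ← Function.iterate_succ_apply']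
  have h2 : orbitAvg f E n φ = (n : ℝ)⁻¹ * ∑ i ∈ Finset.range n, A i := rfl
  rw [h1, h2, ← mul_sub, ← Finset.sum_sub_distrib, Finset.sum_range_sub, abs_mul,
    abs_of_nonneg (by positivity : (0 : ℝ) ≤ (n : ℝ)⁻¹)]
  gcongr
  calc |A n - A 0| ≤ |A n| + |A 0| := abs_sub _ _
    _ ≤ 2 * C := by linarith [hAC n, hAC 0]

variable [TopologicalSpace X] [CompactSpace X] [T2Space X] [MeasurableSpace X] [BorelSpace X]

/-- On a compact Hausdorff space, regular finite measures that integrate continuous functions in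
the same way are equal. -/
lemma ext_of_integral_continuousMap {ν ν' : Measure X} [ν.Regular] [ν'.Regular]
    (h : ∀ φ : C(X, ℝ), ∫ x, φ x ∂ν = ∫ x, φ x ∂ν') : ν = ν' :=
  Measure.ext_of_integral_eq_on_compactlySupported fun φ => h φ.toContinuousMap

/-- Limits along an ultrafilter of empirical averages over orbits of growing length are the
integrals for an invariant regular Borel probability measure. -/
lemma exists_invariant_tendsto_orbitAvg {f : X → X} (hf : Continuous f) (E : ℕ → Finset X)
    (hE : ∀ n, (E n).Nonempty) (l : Ultrafilter ℕ) (hl : (l : Filter ℕ) ≤ atTop) :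
    ∃ ν ∈ invariantMeasures f, ∀ φ : C(X, ℝ),
      Tendsto (fun n => orbitAvg f (E n) n φ) l (𝓝 (∫ x, φ x ∂ν)) := by
  have hlim : ∀ φ : C(X, ℝ), ∃ c, Tendsto (fun n => orbitAvg f (E n) n φ) l (𝓝 c) := by
    intro φ
    have hmem : ∀ n, orbitAvg f (E n) n φ ∈ Icc (-‖φ‖) ‖φ‖ := fun n =>
      abs_le.1 (abs_orbitAvg_le f (E n) n (norm_nonneg φ) φ.norm_coe_le_norm)
    obtain ⟨c, -, hc⟩ := (isCompact_Icc (a := -‖φ‖) (b := ‖φ‖)).ultrafilter_le_nhds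
      (l.map fun n => orbitAvg f (E n) n φ)
      (le_principal_iff.2 (Filter.mem_map.2 (Eventually.of_forall hmem)))
    exact ⟨c, hc⟩
  choose L hL using hlim
  let Λ : CompactlySupportedContinuousMap X ℝ →ₚ[ℝ] ℝ :=
    { toFun := fun g => L g.toContinuousMap
      map_add' := fun g g' => tendsto_nhds_unique (hL _) (by
        refine ((hL g.toContinuousMap).add (hL g'.toContinuousMap)).congr fun n => ?_
        exact (orbitAvg_add _ _ _ _ _).symm)
      map_smul' := fun c g => tendsto_nhds_unique (hL _) (by
        refine ((hL g.toContinuousMap).const_mul c).congr fun n => ?_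
        exact (orbitAvg_smul _ _ _ _ _).symm)
      monotone' := fun g g' h => le_of_tendsto_of_tendsto' (hL _) (hL _) fun n =>
        orbitAvg_mono _ _ _ h }
  set ν := RealRMK.rieszMeasure Λ with hν
  have hint : ∀ φ : C(X, ℝ), ∫ x, φ x ∂ν = L φ := fun φ =>
    RealRMK.integral_rieszMeasure Λ ⟨φ, HasCompactSupport.of_compactSpace φ⟩
  have hpos : ∀ᶠ n in (l : Filter ℕ), 0 < n := hl (eventually_gt_atTop 0)
  have hprob : IsProbabilityMeasure ν := by
    have h1 : L 1 = 1 := tendsto_nhds_unique (hL 1) (by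
      refine tendsto_const_nhds.congr' ?_
      filter_upwards [hpos] with n hn
      exact (orbitAvg_const f (hE n) hn 1).symm)
    have h2 := hint 1
    rw [h1] at h2
    refine ⟨(ENNReal.toReal_eq_one_iff _).1 ?_⟩
    simpa [measureReal_def] using h2
  have hinvL : ∀ φ : C(X, ℝ), L (φ.comp ⟨f, hf⟩) = L φ := by
    intro φ
    have h0 : Tendsto (fun n : ℕ => (n : ℝ)⁻¹ * (2 * ‖φ‖)) l (𝓝 0) := by
      simpa using (tendsto_inv_atTop_nhds_zero_nat.mono_left hl).mul_const (2 * ‖φ‖)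
    have h1 := squeeze_zero_norm
      (f := fun n => orbitAvg f (E n) n (φ ∘ f) - orbitAvg f (E n) n φ)
      (fun n => abs_orbitAvg_comp_sub_le f (E n) n (norm_nonneg φ) φ.norm_coe_le_norm) h0
    exact sub_eq_zero.1 (tendsto_nhds_unique ((hL (φ.comp ⟨f, hf⟩)).sub (hL φ)) h1)
  refine ⟨ν, ⟨hprob, inferInstance, hf.measurable, ?_⟩, fun φ => (hint φ) ▸ hL φ⟩
  have := Measure.InnerRegularCompactLTTop.map_of_continuous (μ := ν) hf
  have hfin : IsProbabilityMeasure (ν.map f) := Measure.isProbabilityMeasure_map hf.aemeasurable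
  refine ext_of_integral_continuousMap fun φ => ?_
  rw [integral_map hf.aemeasurable φ.continuous.aestronglyMeasurable, hint φ, ← hinvL φ, ← hint]
  rfl

end Averages

/-! ### Partitions with null boundaries -/

section NullBoundary

variable {X : Type*} [TopologicalSpace X] [CompactSpace X] [T2Space X] [MeasurableSpace X]
  [BorelSpace X]

/-- The half of the portmanteau theorem for closed sets. -/
lemma eventually_orbitAvg_indicator_le {f : X → X} {E : ℕ → Finset X} {l : Filter ℕ}
    {ν : Measure X} [IsFiniteMeasure ν] [ν.Regular]
    (h : ∀ φ : C(X, ℝ), Tendsto (fun n => orbitAvg f (E n) n φ) l (𝓝 (∫ x, φ x ∂ν)))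
    {F : Set X} (hF : IsClosed F) {ε : ℝ} (hε : 0 < ε) :
    ∀ᶠ n in l, orbitAvg f (E n) n (F.indicator 1) ≤ ν.real F + ε := by
  obtain ⟨O, hFO, hO, hνO⟩ := F.exists_isOpen_lt_add (μ := ν) (measure_ne_top _ _)
    (ε := ENNReal.ofReal ε) (by simpa using hε)
  obtain ⟨φ, hφ0, hφ1, hφ⟩ := exists_continuous_zero_one_of_isClosed hO.isClosed_compl hF
    (disjoint_compl_left_iff_subset.2 hFO)
  have hint : ∫ x, φ x ∂ν ≤ ν.real O := by
    rw [← integral_indicator_one hO.measurableSet]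
    refine integral_mono (φ.continuous.integrable_of_hasCompactSupport
      (HasCompactSupport.of_compactSpace _)) ((integrable_const 1).indicator hO.measurableSet) ?_
    intro x
    by_cases hx : x ∈ O
    · simpa [hx] using (hφ x).2
    · simpa [hx] using (hφ0 hx).le
  have hlt : ν.real O < ν.real F + ε := by
    have := ENNReal.toReal_strict_mono (by simp) hνO
    rwa [ENNReal.toReal_add (measure_ne_top _ _) (by simp), ENNReal.toReal_ofReal hε.le] at this
  filter_upwards [(h φ).eventually_lt_const (hint.trans_lt hlt)] with n hn
  refine (orbitAvg_mono f (E n) n fun x => ?_).trans hn.le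
  by_cases hx : x ∈ F
  · simpa [hx] using (hφ1 hx).ge
  · simpa [hx] using (hφ x).1

/-- Empirical averages of the members of a finite partition with null boundaries converge. -/
lemma tendsto_orbitAvg_indicator_fiber {f : X → X} {E : ℕ → Finset X} (hE : ∀ n, (E n).Nonempty)
    {l : Filter ℕ} (hl : l ≤ atTop) {ν : Measure X} [IsProbabilityMeasure ν] [ν.Regular]
    (h : ∀ φ : C(X, ℝ), Tendsto (fun n => orbitAvg f (E n) n φ) l (𝓝 (∫ x, φ x ∂ν)))
    {κ : Type*} [Fintype κ] {Y : X → κ} (hY : ∀ j, MeasurableSet (Y ⁻¹' {j}))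
    (hY0 : ∀ j, ν (closure (Y ⁻¹' {j}) \ Y ⁻¹' {j}) = 0) (j : κ) :
    Tendsto (fun n => orbitAvg f (E n) n ((Y ⁻¹' {j}).indicator 1)) l
      (𝓝 (ν.real (Y ⁻¹' {j}))) := by
  classical
  have hupper : ∀ ε > 0, ∀ᶠ n in l, ∀ i,
      orbitAvg f (E n) n ((Y ⁻¹' {i}).indicator 1) ≤ ν.real (Y ⁻¹' {i}) + ε := by
    intro ε hε
    refine eventually_all.2 fun i => ?_
    have hcl : ν.real (closure (Y ⁻¹' {i})) = ν.real (Y ⁻¹' {i}) := by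
      refine measureReal_congr (EventuallyLE.antisymm ?_ subset_closure.eventuallyLE)
      exact ae_le_set.2 (hY0 i)
    filter_upwards [eventually_orbitAvg_indicator_le h (isClosed_closure (s := Y ⁻¹' {i})) hε]
      with n hn
    rw [← hcl]
    refine (orbitAvg_mono f (E n) n ?_).trans hn
    exact indicator_le_indicator_of_subset subset_closure fun _ => zero_le_one
  have hsum : ∀ᶠ n in l, ∑ i, orbitAvg f (E n) n ((Y ⁻¹' {i}).indicator 1) = 1 := by
    filter_upwards [hl (eventually_gt_atTop 0)] with n hn
    rw [← orbitAvg_sum]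
    refine Eq.trans ?_ (orbitAvg_const f (hE n) hn 1)
    congr 1
    funext x
    simp [indicator_apply]
  have hν1 : ∑ i, ν.real (Y ⁻¹' {i}) = 1 := sum_measureReal_fiber ν Y hY
  -- The lower bound for one member follows from the upper bounds for all others, since the
  -- frequencies and the measures both add up to `1`.
  refine tendsto_order.2 ⟨fun c hc => ?_, fun c hc => ?_⟩
  · set ε := (ν.real (Y ⁻¹' {j}) - c) / (Fintype.card κ + 1) with hε
    have hcard : (0 : ℝ) < Fintype.card κ + 1 := by positivity
    have hε0 : 0 < ε := div_pos (sub_pos.2 hc) hcard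
    have hε1 : (Fintype.card κ + 1) * ε = ν.real (Y ⁻¹' {j}) - c := by
      rw [hε, mul_div_cancel₀ _ hcard.ne']
    filter_upwards [hupper ε hε0, hsum] with n hn hn1
    have := Finset.sum_le_sum fun i (_ : i ∈ Finset.univ.erase j) => hn i
    rw [Finset.sum_add_distrib, Finset.sum_const, nsmul_eq_mul] at this
    have h1 := Finset.add_sum_erase Finset.univ
      (fun i => orbitAvg f (E n) n ((Y ⁻¹' {i}).indicator 1)) (Finset.mem_univ j)
    have h2 := Finset.add_sum_erase Finset.univ
      (fun i => ν.real (Y ⁻¹' {i})) (Finset.mem_univ j)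
    have h3 : ((Finset.univ.erase j).card : ℝ) * ε ≤ Fintype.card κ * ε := by
      gcongr
      exact_mod_cast Finset.card_le_univ _
    linarith
  · have hε0 : 0 < (c - ν.real (Y ⁻¹' {j})) / 2 := by linarith
    filter_upwards [hupper _ hε0] with n hn
    linarith [hn j]

end NullBoundary

/-- Null boundaries are inherited by the joined partitions of an invariant measure. -/
lemma measure_closure_sdiff_itinerary {X : Type*} [TopologicalSpace X]
    [MeasurableSpace X] {f : X → X} (hf : Continuous f) {ν : Measure X}
    (hν : MeasurePreserving f ν ν) {κ : Type*} {a : X → κ}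
    (ha0 : ∀ i, ν (closure (a ⁻¹' {i}) \ a ⁻¹' {i}) = 0) (n : ℕ)
    (w : Fin n → κ) : ν (closure (itinerary f a n ⁻¹' {w}) \ itinerary f a n ⁻¹' {w}) = 0 := by
  have hsub : closure (itinerary f a n ⁻¹' {w}) \ itinerary f a n ⁻¹' {w} ⊆
      ⋃ i : Fin n, f^[(i : ℕ)] ⁻¹' (closure (a ⁻¹' {w i}) \ a ⁻¹' {w i}) := by
    rintro x ⟨hx, hxw⟩
    have : ∃ i, itinerary f a n x i ≠ w i := by
      by_contra! h
      exact hxw (funext h)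
    obtain ⟨i, hi⟩ := this
    refine mem_iUnion.2 ⟨i, ?_, hi⟩
    have hmaps : MapsTo f^[(i : ℕ)] (itinerary f a n ⁻¹' {w}) (a ⁻¹' {w i}) := by
      rintro y rfl
      rfl
    exact hmaps.closure (hf.iterate i) hx
  refine measure_mono_null hsub (measure_iUnion_null fun i => ?_)
  exact (hν.iterate i).quasiMeasurePreserving.preimage_null (ha0 _)

/-- For every finite measure there are finite measurable partitions into small sets with null
boundaries: they are cut out by generic level sets of Urysohn functions. -/
lemma exists_label_null_boundary {X : Type*} [UniformSpace X] [CompactSpace X] [T2Space X]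
    [MeasurableSpace X] [BorelSpace X] (ν : Measure X) [IsFiniteMeasure ν] {U : SetRel X X}
    (hU : U ∈ 𝓤 X) : ∃ (k : ℕ) (a : X → Fin k), (∀ i, MeasurableSet (a ⁻¹' {i})) ∧
      (∀ i, ν (closure (a ⁻¹' {i}) \ a ⁻¹' {i}) = 0) ∧ ∀ x y, a x = a y → (x, y) ∈ U := by
  classical
  obtain ⟨V, hV, hVs, hVU⟩ := comp_symm_mem_uniformity_sets hU
  have hg : ∀ x : X, ∃ (g : C(X, ℝ)) (t : ℝ), t < g x ∧ (∀ y, t < g y → (x, y) ∈ V) ∧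
      ν {y | g y = t} = 0 := by
    intro x
    have hx : x ∈ interior (UniformSpace.ball x V) :=
      mem_interior_iff_mem_nhds.2 (UniformSpace.ball_mem_nhds x hV)
    obtain ⟨g, hg0, hg1, -⟩ := exists_continuous_zero_one_of_isClosed
      isOpen_interior.isClosed_compl (isClosed_singleton (x := x))
      (disjoint_singleton_right.2 fun h => h hx)
    have hc : {t : ℝ | 0 < ν {y | g y = t}}.Countable :=
      Measure.countable_meas_level_set_pos g.continuous.measurable
    obtain ⟨t, ht, ht01⟩ := (hc.dense_compl ℝ).exists_mem_open (isOpen_Ioo (a := (0 : ℝ)) (b := 1))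
      ⟨1 / 2, by norm_num, by norm_num⟩
    refine ⟨g, t, ?_, fun y hy => ?_, by simpa using ht⟩
    · rw [hg1 rfl]
      exact ht01.2
    · by_contra hyV
      have : y ∈ (interior (UniformSpace.ball x V))ᶜ := fun h =>
        hyV (interior_subset (s := UniformSpace.ball x V) h)
      rw [hg0 this] at hy
      exact absurd hy ht01.1.not_gt
  choose g t hgt hgV hg0 using hg
  obtain ⟨s, hs⟩ := CompactSpace.elim_nhds_subcover (fun x => {y | t x < g x y})
    fun x => (isOpen_lt continuous_const (g x).continuous).mem_nhds (hgt x)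
  let c : Fin s.card → X := fun i => (s.equivFin.symm i : X)
  -- The label of `y` is the index of the first superlevel set that contains it.
  have hfirst : ∀ y, ∃ i : Fin s.card, t (c i) < g (c i) y ∧ ∀ j < i, g (c j) y ≤ t (c j) := by
    intro y
    have hne : {i : Fin s.card | t (c i) < g (c i) y}.Nonempty := by
      have hy : y ∈ ⋃ x ∈ s, {y | t x < g x y} := hs ▸ mem_univ y
      simp only [mem_iUnion, exists_prop] at hy
      obtain ⟨x, hxs, hx⟩ := hy
      exact ⟨s.equivFin ⟨x, hxs⟩, by simpa [c] using hx⟩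
    have hwf : WellFounded (fun i j : Fin s.card => i < j) := wellFounded_lt
    exact ⟨hwf.min _ hne, hwf.min_mem _ hne, fun j hj => not_lt.1 fun h =>
      hwf.not_lt_min _ h hj⟩
  choose a ha using hfirst
  have huniq : ∀ y i, t (c i) < g (c i) y → (∀ j < i, g (c j) y ≤ t (c j)) → a y = i := by
    intro y i h1 h2
    by_contra hne
    rcases lt_or_gt_of_ne hne with hlt | hlt
    · exact absurd (ha y).1 (h2 _ hlt).not_gt
    · exact absurd h1 ((ha y).2 _ hlt).not_gt
  have hfib : ∀ i, a ⁻¹' {i} = {y | t (c i) < g (c i) y} ∩ ⋂ j, ⋂ _ : j < i,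
      {y | g (c j) y ≤ t (c j)} := by
    intro i
    ext y
    simp only [mem_preimage, mem_singleton_iff, mem_inter_iff, mem_ofPred_eq, mem_iInter]
    constructor
    · rintro rfl; exact ha y
    · exact fun h => huniq y i h.1 h.2
  refine ⟨s.card, a, fun i => ?_, fun i => ?_, fun x y hxy => ?_⟩
  · rw [hfib]
    refine (isOpen_lt continuous_const (g _).continuous).measurableSet.inter ?_
    exact MeasurableSet.iInter fun j => MeasurableSet.iInter fun _ =>
      (isClosed_le (g _).continuous continuous_const).measurableSet
  · have hclosed : IsClosed ({y | t (c i) ≤ g (c i) y} ∩ ⋂ j, ⋂ _ : j < i,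
        {y | g (c j) y ≤ t (c j)}) :=
      (isClosed_le continuous_const (g _).continuous).inter <| isClosed_iInter fun j =>
        isClosed_iInter fun _ => isClosed_le (g _).continuous continuous_const
    have hsub : closure (a ⁻¹' {i}) \ a ⁻¹' {i} ⊆ {y | g (c i) y = t (c i)} := by
      rintro y ⟨hy, hya⟩
      have hy' := closure_minimal (by
        rw [hfib i]
        exact inter_subset_inter_left _ fun y (hy : t (c i) < g (c i) y) => hy.le) hclosed hy
      by_contra hne
      refine hya (huniq y i (lt_of_le_of_ne hy'.1 fun h => hne h.symm) fun j hj => ?_)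
      exact mem_iInter₂.1 hy'.2 j hj
    exact measure_mono_null hsub (hg0 _)
  · refine hVU (SetRel.prodMk_mem_comp (hVs.symm _ _ (hgV _ _ (ha x).1)) ?_)
    rw [hxy]
    exact hgV _ _ (ha y).1

/-! ### Topological entropy is at most the supremum of the measure-theoretic entropies -/

/-- Misiurewicz' estimate: if the points of `E` have different itineraries of length `n`, the
entropy of the `q`-blocks for the average over the orbits of length `n` bounds `log #E`. Each
residue class `j` modulo `q` splits the `n`-itinerary into `q`-blocks, up to the first `j`
letters. -/
lemma mul_log_card_le {X : Type*} (f : X → X) {E : Finset X} (hE : E.Nonempty) {k : ℕ}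
    (a : X → Fin k) {n : ℕ} (hn : 0 < n) (hinj : InjOn (itinerary f a n) E) {q : ℕ} (hq : 0 < q) :
    q * Real.log E.card ≤
      n * ∑ w, Real.negMulLog (orbitAvg f E n ((itinerary f a q ⁻¹' {w}).indicator 1)) +
        q * (q * Real.log k) := by
  classical
  have : Nonempty E := hE.to_subtype
  let p : E → ℝ := fun _ => (Fintype.card E : ℝ)⁻¹
  have hcard : (0 : ℝ) < Fintype.card E := by exact_mod_cast Fintype.card_pos
  have hp : ∀ x, 0 ≤ p x := fun _ => inv_nonneg.2 hcard.le
  have hp1 : ∑ x, p x = 1 := by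
    rw [Finset.sum_const, Finset.card_univ, nsmul_eq_mul, mul_inv_cancel₀ hcard.ne']
  let blk : ℕ → E → (Fin q → Fin k) := fun i x => itinerary f a q (f^[i] x)
  have hres : ∀ j ∈ Finset.range q, Real.log E.card ≤
      (∑ i ∈ Finset.range n with i % q = j, shannon p (blk i)) + q * Real.log k := by
    intro j hj
    have hj : j < q := Finset.mem_range.1 hj
    set S := (Finset.range n).filter fun i => i % q = j with hS
    have h1 : Real.log E.card ≤ shannon p (fun x : E => itinerary f a n x) := by
      have := log_card_le_shannon_of_injective (fun x : E => itinerary f a n x)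
        (fun x y h => Subtype.ext (hinj x.2 y.2 h))
      have hE' : Real.log E.card = Real.log (Fintype.card E) := by rw [Fintype.card_coe]
      exact hE'.trans_le this
    have h2 : shannon p (fun x : E => itinerary f a n x) ≤
        shannon p (fun x => ((fun i : S => blk i x), blk 0 x)) := by
      refine shannon_le_of_determined hp _ _ fun x y hxy => ?_
      obtain ⟨hS', h0⟩ := Prod.ext_iff.1 hxy
      funext ⟨r, hr⟩
      by_cases hrj : r < j
      · exact congrFun h0 ⟨r, hrj.trans hj⟩
      · -- The block that contains the time `j + d` starts at `j + q * (d / q)`. Blocks may extend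
        -- beyond the time `n`, which does no harm.
        obtain ⟨d, rfl⟩ := Nat.exists_eq_add_of_le (not_lt.1 hrj)
        have hmod := Nat.mod_add_div d q
        have hlt := Nat.mod_lt d hq
        have hmem : j + q * (d / q) ∈ S := by
          refine Finset.mem_filter.2 ⟨Finset.mem_range.2 (by omega), ?_⟩
          rw [Nat.add_mul_mod_self_left, Nat.mod_eq_of_lt hj]
        have := congrFun (congrFun hS' ⟨_, hmem⟩) ⟨d % q, hlt⟩
        simp only [blk, itinerary, ← Function.iterate_add_apply] at this ⊢
        rwa [show d % q + (j + q * (d / q)) = j + d by omega] at this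
    have h3 : shannon p (blk 0) ≤ q * Real.log k := by
      have := shannon_le_log_card_univ hp hp1 (blk 0)
      simpa [Real.log_pow] using this
    have h4 := shannon_prod_le hp hp1 (fun x (i : S) => blk i x) (blk 0)
    have h5 := shannon_pi_le hp hp1 blk S
    linarith
  have hsum := Finset.sum_le_sum hres
  rw [Finset.sum_add_distrib, Finset.sum_const, Finset.sum_const, Finset.card_range, nsmul_eq_mul,
    nsmul_eq_mul, Finset.sum_fiberwise_of_maps_to
      (fun i _ => Finset.mem_range.2 (Nat.mod_lt i hq))] at hsum
  refine hsum.trans (add_le_add_left ?_ _)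
  refine (sum_negMulLog_le_card_mul hn (fun i => law p (blk i))
    fun i => law_nonneg hp _).trans_eq ?_
  congr 1
  refine Finset.sum_congr rfl fun w _ => ?_
  congr 1
  unfold orbitAvg
  congr 1
  refine Finset.sum_congr rfl fun i _ => ?_
  rw [law, Finset.sum_filter, Finset.mul_sum, ← Finset.sum_coe_sort E]
  refine Finset.sum_congr rfl fun x _ => ?_
  simp [indicator_apply, p, blk]

section LowerBound

variable {X : Type*} [UniformSpace X] [CompactSpace X] [T2Space X] [MeasurableSpace X]
  [BorelSpace X]

/-- Dynamical nets of exponential size at rate `c`, at infinitely many times, yield an invariant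
measure of entropy at least `c`. -/
lemma exists_invariant_measureEntropy_ge {f : X → X} (hf : Continuous f) {U : SetRel X X}
    (hU : U ∈ 𝓤 X) {c : ℝ} (hc : c < Dynamics.netEntropyEntourage f univ U) :
    ∃ ν ∈ invariantMeasures f, (c : EReal) ≤ measureEntropy ν f := by
  classical
  have hfreq := frequently_lt_of_lt_limsup (by isBoundedDefault) hc
  let S : Set ℕ := {n | ∃ E : Finset X, E.Nonempty ∧ Dynamics.IsDynNetIn f univ U n E ∧
    c * n ≤ Real.log E.card}
  have hS : ∃ᶠ n in atTop, n ∈ S := by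
    refine (hfreq.and_eventually (eventually_gt_atTop 0)).mono fun n hn => ?_
    obtain ⟨hn, hn0⟩ := hn
    beta_reduce at hn
    have hfin : Dynamics.netMaxcard f univ U n < ⊤ :=
      (Dynamics.netMaxcard_le_coverMincard f univ n).trans_lt
        (Dynamics.coverMincard_finite_of_isCompact_uniformContinuous isCompact_univ
          (CompactSpace.uniformContinuous_of_continuous hf) hU n)
    obtain ⟨E, hE, hEc⟩ := (Dynamics.netMaxcard_finite_iff f univ U n).1 hfin
    have hn0' : (0 : ℝ) < n := by exact_mod_cast hn0
    have hpos : 0 < E.card := by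
      rw [Nat.pos_iff_ne_zero]
      intro h0
      rw [← hEc, h0] at hn
      simp [EReal.bot_div_of_pos_ne_top (by exact_mod_cast hn0' : (0 : EReal) < (n : EReal))
        (EReal.natCast_ne_top n)] at hn
    refine ⟨E, Finset.card_pos.1 hpos, hE, ?_⟩
    have e1 : ENNReal.log ((Dynamics.netMaxcard f univ U n : ℕ∞) : ENNReal) =
        (Real.log E.card : ℝ) := by
      rw [← hEc, ← ENNReal.log_ofReal_of_pos (by exact_mod_cast hpos)]
      simp
    rw [e1, EReal.lt_div_iff (by exact_mod_cast hn0') (EReal.natCast_ne_top _)] at hn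
    exact_mod_cast hn.le
  obtain ⟨n₀, E₀, ⟨x₀, -⟩, -⟩ := hS.exists
  -- The values of `E` outside `S` do not matter: the ultrafilter `l` below contains `S`.
  let E : ℕ → Finset X := fun n => if h : n ∈ S then h.choose else {x₀}
  have hE : ∀ n, (E n).Nonempty := by
    intro n
    by_cases h : n ∈ S
    · simp only [E, dif_pos h]
      exact h.choose_spec.1
    · simp [E, dif_neg h]
  have hES : ∀ n ∈ S, Dynamics.IsDynNetIn f univ U n (E n) ∧ c * n ≤ Real.log (E n).card := by
    intro n h
    simp only [E, dif_pos h]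
    exact h.choose_spec.2
  have hne : (atTop ⊓ 𝓟 S : Filter ℕ).NeBot := frequently_mem_iff_neBot.1 hS
  let l : Ultrafilter ℕ := Ultrafilter.of (atTop ⊓ 𝓟 S)
  have hl : (l : Filter ℕ) ≤ atTop := (Ultrafilter.of_le _).trans inf_le_left
  have hlS : ∀ᶠ n in (l : Filter ℕ), n ∈ S :=
    (Ultrafilter.of_le (atTop ⊓ 𝓟 S)) (mem_inf_of_right (mem_principal_self S))
  obtain ⟨ν, hν, hlim⟩ := exists_invariant_tendsto_orbitAvg hf E hE l hl
  obtain ⟨hprob, hreg, hinv⟩ := hν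
  refine ⟨ν, ⟨hprob, hreg, hinv⟩, ?_⟩
  obtain ⟨k, a, ham, ha0, haU⟩ := exists_label_null_boundary ν hU
  have hpart : IsMeasurePartition ν fun i => a ⁻¹' {i} := by
    refine ⟨ham, ?_, fun i j hij => ?_⟩
    · have : (⋃ i, a ⁻¹' {i}) = univ := by ext; simp
      rw [this, measure_univ]
    · rw [(Disjoint.preimage a (by simpa using hij)).inter_eq, measure_empty]
  have hinj : ∀ n ∈ S, 0 < n → InjOn (itinerary f a n) (E n) := by
    intro n hn hn0 x hx y hy hxy
    by_contra hne
    exact Set.disjoint_left.1 ((hES n hn).1.2 hx hy hne)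
      (show y ∈ UniformSpace.ball x (Dynamics.dynEntourage f U n) from
        Dynamics.mem_ball_dynEntourage.2 fun i hi => haU _ _ (congrFun hxy ⟨i, hi⟩))
      (Dynamics.mem_ball_dynEntourage.2 fun i hi => refl_mem_uniformity hU)
  have hblock : ∀ q : ℕ, 0 < q → q * c ≤
      partitionEntropy ν (iteratedJoin f (fun i => a ⁻¹' {i}) q) := by
    intro q hq
    have hconv : Tendsto (fun n : ℕ => ∑ w, Real.negMulLog
        (orbitAvg f (E n) n ((itinerary f a q ⁻¹' {w}).indicator 1)) +
          (n : ℝ)⁻¹ * (q * (q * Real.log k))) l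
        (𝓝 ((∑ w, Real.negMulLog (ν.real (itinerary f a q ⁻¹' {w}))) +
          0 * (q * (q * Real.log k)))) := by
      refine Tendsto.add (tendsto_finsetSum _ fun w _ => ?_)
        ((tendsto_inv_atTop_nhds_zero_nat.mono_left hl).mul_const _)
      refine (Real.continuous_negMulLog.tendsto _).comp ?_
      exact tendsto_orbitAvg_indicator_fiber hE hl hlim
        (measurableSet_itinerary_fiber hf.measurable ham q)
        (measure_closure_sdiff_itinerary hf hinv ha0 q) w
    have hle := ge_of_tendsto hconv (b := q * c) (by
      filter_upwards [hlS, hl (eventually_gt_atTop 0)] with n hn hn0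
      have h1 := mul_log_card_le f (hE n) a hn0 (hinj n hn hn0) hq
      have h2 := (hES n hn).2
      have hn0' : (0 : ℝ) < n := by exact_mod_cast hn0
      rw [← mul_le_mul_iff_right₀ hn0', mul_add, mul_inv_cancel_left₀ hn0'.ne']
      refine le_trans ?_ h1
      calc (n : ℝ) * (q * c) = q * (c * n) := by ring
        _ ≤ q * Real.log (E n).card := by gcongr)
    rw [zero_mul, add_zero] at hle
    refine hle.trans_eq (Finset.sum_congr rfl fun w _ => ?_)
    rw [iteratedJoin_fiber]
  refine le_trans (le_iInf fun n => ?_)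
    (le_iSup_of_le k (le_iSup₂_of_le (fun i => a ⁻¹' {i}) hpart le_rfl))
  rw [EReal.coe_le_coe_iff, le_div_iff₀ (by positivity)]
  have := hblock (n + 1) n.succ_pos
  push_cast at this
  linarith

/-- The variational principle for continuous maps of compact Hausdorff uniform spaces. -/
theorem iSup_measureEntropy_eq_coverEntropy {f : X → X} (hf : Continuous f) :
    ⨆ ν ∈ invariantMeasures f, measureEntropy ν f = Dynamics.coverEntropy f univ := by
  refine le_antisymm (iSup₂_le fun ν hν => measureEntropy_le_coverEntropy hf hν) ?_
  refine EReal.ge_of_forall_gt_iff_ge.1 fun c hc => ?_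
  rw [Dynamics.coverEntropy_eq_iSup_netEntropyEntourage] at hc
  obtain ⟨U, hU⟩ := lt_iSup_iff.1 hc
  obtain ⟨hU, hcU⟩ := lt_iSup_iff.1 hU
  obtain ⟨ν, hν, hcν⟩ := exists_invariant_measureEntropy_ge hf hU hcU
  exact hcν.trans (le_iSup₂_of_le ν hν le_rfl)

end LowerBound

/-! ### Suprema of positive strong submeasures -/

section Suprema

variable {X : Type*} [TopologicalSpace X] [CompactSpace X]

/-- The functional `φ ↦ max φ`; it dominates every probability measure. -/
def maxFunctional (φ : C(X, ℝ)) : ℝ := ⨆ x, φ x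

lemma le_maxFunctional (φ : C(X, ℝ)) (x : X) : φ x ≤ maxFunctional φ :=
  le_ciSup (isCompact_range φ.continuous).bddAbove x

lemma maxFunctional_const {X : Type*} [TopologicalSpace X] [Nonempty X] (c : ℝ) :
    maxFunctional (ContinuousMap.const X c) = c := by
  simp [maxFunctional]

lemma isPositiveStrongSubmeasure_maxFunctional [Nonempty X] :
    IsPositiveStrongSubmeasure (maxFunctional (X := X)) where
  add_le φ ψ := ciSup_le fun x => add_le_add (le_maxFunctional φ x) (le_maxFunctional ψ x)
  smul_eq c φ hc := (Real.mul_iSup_of_nonneg hc _).symm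
  bounded := by
    refine ⟨1, one_pos, fun φ => ?_⟩
    rw [one_mul, abs_le]
    obtain ⟨x⟩ := ‹Nonempty X›
    have : Nonempty X := ⟨x⟩
    have h := fun x => abs_le.1 (φ.norm_coe_le_norm x)
    exact ⟨(h x).1.trans (le_maxFunctional φ x), ciSup_le fun y => (h y).2⟩
  mono φ ψ h := ciSup_le fun x => (h x).trans (le_maxFunctional ψ x)

/-- The pointwise supremum of a bounded family of positive strong submeasures. -/
lemma isPositiveStrongSubmeasure_sSup {T : Set (C(X, ℝ) → ℝ)} {M : C(X, ℝ) → ℝ}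
    (hT : T.Nonempty) (hTP : ∀ σ ∈ T, IsPositiveStrongSubmeasure σ)
    (hM : IsPositiveStrongSubmeasure M) (hTM : ∀ σ ∈ T, σ ≤ M) {μ : C(X, ℝ) → ℝ}
    (hμ : ∀ φ, IsLUB ((fun σ => σ φ) '' T) (μ φ)) : IsPositiveStrongSubmeasure μ := by
  have hle : ∀ σ ∈ T, ∀ φ, σ φ ≤ μ φ := fun σ hσ φ => (hμ φ).1 (mem_image_of_mem _ hσ)
  have hge : ∀ φ c, (∀ σ ∈ T, σ φ ≤ c) → μ φ ≤ c := fun φ c h =>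
    (hμ φ).2 (forall_mem_image.2 h)
  obtain ⟨σ₀, hσ₀⟩ := hT
  refine ⟨⟨fun φ ψ => ?_, fun c φ hc => ?_, ?_⟩, fun φ ψ h => ?_⟩
  · exact hge _ _ fun σ hσ => ((hTP σ hσ).add_le φ ψ).trans
      (add_le_add (hle σ hσ φ) (hle σ hσ ψ))
  · have hup : ∀ (c : ℝ) (φ : C(X, ℝ)), 0 ≤ c → μ (c • φ) ≤ c * μ φ := fun c φ hc =>
      hge _ _ fun σ hσ => by
        rw [(hTP σ hσ).smul_eq c φ hc]
        exact mul_le_mul_of_nonneg_left (hle σ hσ φ) hc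
    refine le_antisymm (hup c φ hc) ?_
    rcases hc.eq_or_lt with rfl | hc
    · have := hle σ₀ hσ₀ ((0 : ℝ) • φ)
      rw [(hTP σ₀ hσ₀).smul_eq 0 φ le_rfl] at this
      simpa using this
    · have := hup c⁻¹ (c • φ) (inv_nonneg.2 hc.le)
      rwa [inv_smul_smul₀ hc.ne', inv_mul_eq_div, le_div_iff₀' hc] at this
  · obtain ⟨C, hC, hCb⟩ := hM.bounded
    obtain ⟨C', hC', hCb'⟩ := (hTP σ₀ hσ₀).bounded
    refine ⟨C + C', by positivity, fun φ => abs_le.2 ⟨?_, ?_⟩⟩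
    · have := (abs_le.1 (hCb' φ)).1
      have h2 := hle σ₀ hσ₀ φ
      nlinarith [norm_nonneg φ]
    · have := (abs_le.1 (hCb φ)).2
      have h2 := hge φ (M φ) fun σ hσ => hTM σ hσ φ
      nlinarith [norm_nonneg φ]
  · exact hge _ _ fun σ hσ => ((hTP σ hσ).mono φ ψ h).trans (hle σ hσ ψ)

/-- A monotone operator on positive strong submeasures has a smallest fixed point above `μ₀`, and
this one is below `M`, if `μ₀ ≤ F μ₀`, `F M ≤ M` and `μ₀ ≤ M` (Knaster–Tarski): it is the largest
positive strong submeasure below all `μ ≥ μ₀` with `F μ ≤ μ`. -/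
lemma exists_isLeast_fixedPoint (F : (C(X, ℝ) → ℝ) → (C(X, ℝ) → ℝ))
    (hF : ∀ μ, IsPositiveStrongSubmeasure μ → IsPositiveStrongSubmeasure (F μ))
    (hFmono : ∀ μ μ', IsPositiveStrongSubmeasure μ → IsPositiveStrongSubmeasure μ' → μ ≤ μ' →
      F μ ≤ F μ') {μ₀ M : C(X, ℝ) → ℝ} (hμ₀ : IsPositiveStrongSubmeasure μ₀)
    (hM : IsPositiveStrongSubmeasure M) (hμ₀M : μ₀ ≤ M) (hFμ₀ : μ₀ ≤ F μ₀) (hFM : F M ≤ M) :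
    ∃ μ, IsLeast {μ' | IsPositiveStrongSubmeasure μ' ∧ μ₀ ≤ μ' ∧ F μ' = μ'} μ ∧ μ ≤ M := by
  let S : Set (C(X, ℝ) → ℝ) := {μ' | IsPositiveStrongSubmeasure μ' ∧ μ₀ ≤ μ' ∧ F μ' ≤ μ'}
  let T : Set (C(X, ℝ) → ℝ) := {σ | IsPositiveStrongSubmeasure σ ∧ ∀ μ' ∈ S, σ ≤ μ'}
  have hMS : M ∈ S := ⟨hM, hμ₀M, hFM⟩
  have hμ₀T : μ₀ ∈ T := ⟨hμ₀, fun μ' h => h.2.1⟩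
  let μ : C(X, ℝ) → ℝ := fun φ => sSup ((fun σ => σ φ) '' T)
  have hlub : ∀ φ, IsLUB ((fun σ => σ φ) '' T) (μ φ) := fun φ =>
    isLUB_csSup ⟨_, mem_image_of_mem _ hμ₀T⟩ ⟨M φ, forall_mem_image.2 fun σ hσ => hσ.2 M hMS φ⟩
  have hle : ∀ σ ∈ T, σ ≤ μ := fun σ hσ φ => (hlub φ).1 (mem_image_of_mem _ hσ)
  have hμS : ∀ μ' ∈ S, μ ≤ μ' := fun μ' hμ' φ =>
    (hlub φ).2 (forall_mem_image.2 fun σ hσ => hσ.2 μ' hμ' φ)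
  have hμ : IsPositiveStrongSubmeasure μ :=
    isPositiveStrongSubmeasure_sSup ⟨_, hμ₀T⟩ (fun σ hσ => hσ.1) hM (fun σ hσ => hσ.2 M hMS) hlub
  have h1 : F μ ≤ μ := hle _ ⟨hF μ hμ, fun μ' hμ' =>
    (hFmono μ μ' hμ hμ'.1 (hμS μ' hμ')).trans hμ'.2.2⟩
  have h0 : μ₀ ≤ μ := hle _ hμ₀T
  have h2 : μ ≤ F μ := hμS _ ⟨hF μ hμ, hFμ₀.trans (hFmono _ _ hμ₀ hμ h0),
    hFmono _ _ (hF μ hμ) hμ h1⟩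
  exact ⟨μ, ⟨⟨hμ, h0, h1.antisymm h2⟩, fun μ' h => hμS μ' ⟨h.1, h.2.1, h.2.2.le⟩⟩, hμS M hMS⟩

lemma IsPositiveStrongSubmeasure.pushforward {Y : Type*} [TopologicalSpace Y] [CompactSpace Y]
    {μ : C(X, ℝ) → ℝ} (hμ : IsPositiveStrongSubmeasure μ) (g : C(X, Y)) :
    IsPositiveStrongSubmeasure (pushforward g μ) where
  add_le φ ψ := hμ.add_le (φ.comp g) (ψ.comp g)
  smul_eq c φ hc := hμ.smul_eq c (φ.comp g) hc
  bounded := by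
    obtain ⟨C, hC, h⟩ := hμ.bounded
    refine ⟨C, hC, fun φ => (h _).trans ?_⟩
    gcongr
    exact (ContinuousMap.norm_le _ (norm_nonneg φ)).2 fun x => φ.norm_coe_le_norm _
  mono φ ψ h := hμ.mono _ _ fun x => h (g x)

variable [MeasurableSpace X] [BorelSpace X]

lemma integrable_continuousMap (ν : Measure X) [IsFiniteMeasure ν] (φ : C(X, ℝ)) :
    Integrable φ ν :=
  Integrable.of_bound φ.continuous.measurable.aestronglyMeasurable ‖φ‖
    (Eventually.of_forall φ.norm_coe_le_norm)

lemma ofMeasure_const {X : Type*} [TopologicalSpace X] [MeasurableSpace X] (ν : Measure X)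
    [IsProbabilityMeasure ν] (c : ℝ) :
    ofMeasure ν (ContinuousMap.const X c) = c := by
  simp [ofMeasure]

lemma isPositiveStrongSubmeasure_ofMeasure (ν : Measure X) [IsProbabilityMeasure ν] :
    IsPositiveStrongSubmeasure (ofMeasure ν) where
  add_le φ ψ := (integral_add (integrable_continuousMap ν φ) (integrable_continuousMap ν ψ)).le
  smul_eq c φ _ := integral_const_mul c φ
  bounded := ⟨1, one_pos, fun φ => by
    simpa [ofMeasure] using norm_integral_le_of_norm_le_const (μ := ν)
      (Eventually.of_forall φ.norm_coe_le_norm)⟩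
  mono φ ψ h := integral_mono (integrable_continuousMap ν φ) (integrable_continuousMap ν ψ) h

lemma ofMeasure_le_maxFunctional (ν : Measure X) [IsProbabilityMeasure ν] :
    ofMeasure ν ≤ maxFunctional := fun φ =>
  ((isPositiveStrongSubmeasure_ofMeasure ν).mono φ (ContinuousMap.const X (maxFunctional φ))
    (le_maxFunctional φ)).trans_eq (ofMeasure_const ν _)

end Suprema

/-! ### The supremum of all invariant measures -/

section Continuous

variable {X : Type*} [TopologicalSpace X] [CompactSpace X] [T2Space X]
  [MeasurableSpace X] [BorelSpace X]

/-- The variational principle for continuous maps of compact Hausdorff spaces. -/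
theorem iSup_measureEntropy_eq_topEntropy (f : C(X, X)) :
    ⨆ ν ∈ invariantMeasures f, measureEntropy ν f = topEntropy f := by
  -- The uniform structure in `topEntropy` is transported to a space on which it is the instance.
  have key : ∀ {Z : Type _} (t : TopologicalSpace Z) (u : UniformSpace Z),
      u.toTopologicalSpace = t → ∀ [CompactSpace Z] [T2Space Z] [MeasurableSpace Z]
      [BorelSpace Z] (f : C(Z, Z)),
      ⨆ ν ∈ invariantMeasures f, measureEntropy ν f = @Dynamics.coverEntropy Z u f univ := by
    rintro Z t u rfl _ _ _ _ f
    exact iSup_measureEntropy_eq_coverEntropy f.continuous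
  exact key _ uniformSpaceOfCompactR1 rfl f

lemma entropy_le_topEntropy (f : C(X, X)) (μ : C(X, ℝ) → ℝ) : entropy f μ ≤ topEntropy f := by
  rw [← iSup_measureEntropy_eq_topEntropy]
  exact biSup_mono fun ν hν => hν.1

lemma invariantMeasures_nonempty [Nonempty X] (f : C(X, X)) : (invariantMeasures f).Nonempty := by
  obtain ⟨x₀⟩ := ‹Nonempty X›
  obtain ⟨ν, hν, -⟩ := exists_invariant_tendsto_orbitAvg f.continuous (fun _ => {x₀})
    (fun _ => Finset.singleton_nonempty x₀) (hyperfilter ℕ) Nat.hyperfilter_le_atTop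
  exact ⟨ν, hν⟩

/-- The supremum of all invariant measures is an invariant positive strong submeasure of mass `1`
and of full entropy. -/
lemma exists_isSupOfMeasures_invariantMeasures [Nonempty X] (f : C(X, X)) :
    ∃ μ : C(X, ℝ) → ℝ, IsSupOfMeasures (invariantMeasures f) μ ∧ IsPositiveStrongSubmeasure μ ∧
      μ ≤ maxFunctional ∧ μ 1 = 1 ∧ pushforward f μ = μ ∧ entropy f μ = topEntropy f := by
  obtain ⟨ν₀, hν₀⟩ := invariantMeasures_nonempty f
  have hmax : ∀ ν ∈ invariantMeasures f, ofMeasure ν ≤ maxFunctional := fun ν hν =>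
    have := hν.1
    ofMeasure_le_maxFunctional ν
  let μ : C(X, ℝ) → ℝ := fun φ => sSup ((fun ν => ofMeasure ν φ) '' invariantMeasures f)
  have hlub : IsSupOfMeasures (invariantMeasures f) μ := fun φ =>
    isLUB_csSup ⟨_, mem_image_of_mem _ hν₀⟩
      ⟨maxFunctional φ, forall_mem_image.2 fun ν hν => hmax ν hν φ⟩
  have hle : ∀ ν ∈ invariantMeasures f, ofMeasure ν ≤ μ := fun ν hν φ =>
    (hlub φ).1 (mem_image_of_mem _ hν)
  refine ⟨μ, hlub, ?_, fun φ => (hlub φ).2 (forall_mem_image.2 fun ν hν => hmax ν hν φ), ?_, ?_, ?_⟩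
  · refine isPositiveStrongSubmeasure_sSup (T := ofMeasure '' invariantMeasures f)
      ⟨_, mem_image_of_mem _ hν₀⟩ ?_ isPositiveStrongSubmeasure_maxFunctional
      (forall_mem_image.2 hmax) fun φ => ?_
    · refine forall_mem_image.2 fun ν hν => ?_
      have := hν.1
      exact isPositiveStrongSubmeasure_ofMeasure ν
    · rw [image_image]
      exact hlub φ
  · refine (hlub 1).unique ?_
    have : (fun ν : Measure X => ofMeasure ν 1) '' invariantMeasures f = {1} := by
      refine Subset.antisymm (image_subset_iff.2 fun ν hν => ?_)
        (singleton_subset_iff.2 ⟨ν₀, hν₀, ?_⟩)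
      · have := hν.1
        exact ofMeasure_const ν 1
      · have := hν₀.1
        exact ofMeasure_const ν₀ 1
    rw [this]
    exact isLUB_singleton
  · funext φ
    change sSup _ = sSup _
    congr 1
    refine image_congr fun ν hν => ?_
    have hmap := integral_map hν.2.2.aemeasurable (φ.continuous.measurable.aestronglyMeasurable)
    rw [hν.2.2.map_eq] at hmap
    exact hmap.symm
  · refine (entropy_le_topEntropy f μ).antisymm ?_
    rw [← iSup_measureEntropy_eq_topEntropy]
    exact biSup_mono fun ν hν => ⟨hν, hle ν hν⟩

end Continuous

/-! ### Open-dense defined maps -/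

namespace OpenDenseMap

section Push

variable {X Y : Type*} [TopologicalSpace X] [TopologicalSpace Y] (f : OpenDenseMap X Y)

lemma dense_openDom : Dense f.openDom :=
  f.dense_dom.mono (subset_sUnion_of_mem
    ⟨f.isOpen_dom, f.toFun, f.continuousOn_toFun, fun _ _ => rfl⟩)

lemma neBot_nhdsWithin_openDom (x : X) : (𝓝[f.openDom] x).NeBot :=
  mem_closure_iff_nhdsWithin_neBot.1 (f.dense_openDom x)

lemma pullback_of_mem {φ : C(Y, ℝ)} {x : X} (hx : x ∈ f.openDom) :
    f.pullback φ x = φ (f.ext x) := if_pos hx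

lemma pullback_of_notMem {φ : C(Y, ℝ)} {x : X} (hx : x ∉ f.openDom) :
    f.pullback φ x = limsup (fun y => φ (f.ext y)) (𝓝[f.openDom] x) := if_neg hx

lemma pullback_const (c : ℝ) (x : X) : f.pullback (ContinuousMap.const Y c) x = c := by
  have := f.neBot_nhdsWithin_openDom x
  by_cases hx : x ∈ f.openDom
  · rw [f.pullback_of_mem hx]; rfl
  · rw [f.pullback_of_notMem hx]
    exact limsup_const c

variable [CompactSpace Y]

lemma isBoundedUnder_le_ext (φ : C(Y, ℝ)) (l : Filter X) :
    l.IsBoundedUnder (· ≤ ·) fun y => φ (f.ext y) :=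
  isBoundedUnder_of ⟨‖φ‖, fun _ => (abs_le.1 (φ.norm_coe_le_norm _)).2⟩

lemma isBoundedUnder_ge_ext (φ : C(Y, ℝ)) (l : Filter X) :
    l.IsBoundedUnder (· ≥ ·) fun y => φ (f.ext y) :=
  isBoundedUnder_of ⟨-‖φ‖, fun _ => (abs_le.1 (φ.norm_coe_le_norm _)).1⟩

lemma pullback_mono {φ ψ : C(Y, ℝ)} (h : φ ≤ ψ) (x : X) : f.pullback φ x ≤ f.pullback ψ x := by
  have := f.neBot_nhdsWithin_openDom x
  by_cases hx : x ∈ f.openDom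
  · rw [f.pullback_of_mem hx, f.pullback_of_mem hx]
    exact h _
  · rw [f.pullback_of_notMem hx, f.pullback_of_notMem hx]
    exact limsup_le_limsup (Eventually.of_forall fun y => h _)
      (f.isBoundedUnder_ge_ext φ _).isCoboundedUnder_le (f.isBoundedUnder_le_ext ψ _)

lemma pullback_add_le (φ ψ : C(Y, ℝ)) (x : X) :
    f.pullback (φ + ψ) x ≤ f.pullback φ x + f.pullback ψ x := by
  have := f.neBot_nhdsWithin_openDom x
  by_cases hx : x ∈ f.openDom
  · simp only [f.pullback_of_mem hx, ContinuousMap.add_apply, le_refl]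
  · simp only [f.pullback_of_notMem hx]
    exact limsup_add_le (f.isBoundedUnder_ge_ext φ _) (f.isBoundedUnder_le_ext φ _)
      (f.isBoundedUnder_ge_ext ψ _).isCoboundedUnder_le (f.isBoundedUnder_le_ext ψ _)

lemma pullback_smul {c : ℝ} (hc : 0 ≤ c) (φ : C(Y, ℝ)) (x : X) :
    f.pullback (c • φ) x = c * f.pullback φ x := by
  have := f.neBot_nhdsWithin_openDom x
  by_cases hx : x ∈ f.openDom
  · simp [f.pullback_of_mem hx]
  · simp only [f.pullback_of_notMem hx]
    exact ((monotone_mul_left_of_nonneg hc).map_limsup_of_continuousAt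
      (fun y => φ (f.ext y)) (continuous_const_mul c).continuousAt
      (f.isBoundedUnder_le_ext φ _) (f.isBoundedUnder_ge_ext φ _).isCoboundedUnder_le).symm

variable {f} [CompactSpace X] {μ : C(X, ℝ) → ℝ}

/-- The defining property of `f_* μ`; the infimum is over a non-empty set that is bounded below. -/
lemma isGLB_push (hμ : IsPositiveStrongSubmeasure μ) (φ : C(Y, ℝ)) :
    IsGLB (μ '' {ψ : C(X, ℝ) | ∀ x, f.pullback φ x ≤ ψ x}) (f.push μ φ) := by
  have hφ := fun y => abs_le.1 (φ.norm_coe_le_norm y)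
  refine isGLB_csInf ⟨_, ContinuousMap.const X ‖φ‖, fun x => ?_, rfl⟩
    ⟨μ (ContinuousMap.const X (-‖φ‖)), forall_mem_image.2 fun ψ hψ => hμ.mono _ _ fun x => ?_⟩
  · exact (f.pullback_mono (ψ := ContinuousMap.const Y ‖φ‖) (fun y => (hφ y).2) x).trans_eq
      (f.pullback_const _ x)
  · exact (f.pullback_const (-‖φ‖) x).symm.trans_le
      ((f.pullback_mono (fun y => (hφ y).1) x).trans (hψ x))

lemma push_le (hμ : IsPositiveStrongSubmeasure μ) {φ : C(Y, ℝ)} {ψ : C(X, ℝ)}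
    (h : ∀ x, f.pullback φ x ≤ ψ x) : f.push μ φ ≤ μ ψ :=
  (isGLB_push hμ φ).1 (mem_image_of_mem μ h)

lemma le_push (hμ : IsPositiveStrongSubmeasure μ) {φ : C(Y, ℝ)} {c : ℝ}
    (h : ∀ ψ : C(X, ℝ), (∀ x, f.pullback φ x ≤ ψ x) → c ≤ μ ψ) : c ≤ f.push μ φ :=
  (isGLB_push hμ φ).2 (forall_mem_image.2 h)

lemma isPositiveStrongSubmeasure_push (hμ : IsPositiveStrongSubmeasure μ) :
    IsPositiveStrongSubmeasure (f.push μ) := by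
  have hmono : ∀ φ ψ : C(Y, ℝ), φ ≤ ψ → f.push μ φ ≤ f.push μ ψ := fun φ ψ h =>
    le_push hμ fun χ hχ => push_le hμ fun x => (f.pullback_mono h x).trans (hχ x)
  have hsmul : ∀ (c : ℝ) (φ : C(Y, ℝ)), 0 < c → c * f.push μ φ ≤ f.push μ (c • φ) := by
    intro c φ hc
    refine le_push hμ fun ψ hψ => ?_
    rw [← le_div_iff₀' hc, ← inv_mul_eq_div, ← hμ.smul_eq _ _ (inv_nonneg.2 hc.le)]
    refine push_le hμ fun x => ?_
    have := hψ x
    rw [f.pullback_smul hc.le] at this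
    rw [ContinuousMap.smul_apply, smul_eq_mul, inv_mul_eq_div, le_div_iff₀' hc]
    exact this
  refine ⟨⟨fun φ ψ => ?_, fun c φ hc => ?_, ?_⟩, hmono⟩
  · rw [← sub_le_iff_le_add]
    refine le_push hμ fun χ hχ => ?_
    rw [sub_le_comm]
    refine le_push hμ fun χ' hχ' => ?_
    rw [sub_le_iff_le_add]
    refine (push_le hμ fun x => ?_).trans (hμ.add_le χ' χ)
    refine (f.pullback_add_le φ ψ x).trans ?_
    rw [ContinuousMap.add_apply, add_comm]
    exact add_le_add (hχ' x) (hχ x)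
  · rcases hc.eq_or_lt with rfl | hc
    · have h0 : μ (ContinuousMap.const X 0) = 0 := by
        have := hμ.smul_eq 0 (ContinuousMap.const X 0) le_rfl
        rwa [zero_mul, zero_smul] at this
      have hp : ∀ x, f.pullback ((0 : ℝ) • φ) x = 0 := fun x => by
        rw [f.pullback_smul le_rfl, zero_mul]
      rw [zero_mul]
      refine le_antisymm ((push_le hμ fun x => (hp x).le).trans_eq h0) (le_push hμ fun ψ hψ => ?_)
      exact h0.symm.trans_le (hμ.mono _ _ fun x => (hp x).symm.trans_le (hψ x))
    · refine le_antisymm ?_ (hsmul c φ hc)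
      have := hsmul c⁻¹ (c • φ) (inv_pos.2 hc)
      rwa [inv_smul_smul₀ hc.ne', inv_mul_eq_div, div_le_iff₀' hc] at this
  · obtain ⟨C, hC, hb⟩ := hμ.bounded
    have hconst : ∀ c : ℝ, |μ (ContinuousMap.const X c)| ≤ C * |c| := fun c => (hb _).trans <| by
      gcongr
      exact (ContinuousMap.norm_le _ (abs_nonneg c)).2 fun _ => le_rfl
    refine ⟨C, hC, fun φ => abs_le.2 ?_⟩
    have hφ := fun y => abs_le.1 (φ.norm_coe_le_norm y)
    constructor
    · have h1 := (abs_le.1 (hconst (-‖φ‖))).1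
      rw [abs_neg, abs_norm] at h1
      refine h1.trans (le_push hμ fun ψ hψ => hμ.mono _ _ fun x => ?_)
      exact (f.pullback_const (-‖φ‖) x).symm.trans_le
        ((f.pullback_mono (fun y => (hφ y).1) x).trans (hψ x))
    · have h1 := (abs_le.1 (hconst ‖φ‖)).2
      rw [abs_norm] at h1
      refine (push_le hμ fun x => ?_).trans h1
      exact (f.pullback_mono (ψ := ContinuousMap.const Y ‖φ‖) (fun y => (hφ y).2) x).trans_eq
        (f.pullback_const _ x)

lemma push_mono {μ' : C(X, ℝ) → ℝ} (hμ : IsPositiveStrongSubmeasure μ)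
    (hμ' : IsPositiveStrongSubmeasure μ') (h : μ ≤ μ') : f.push μ ≤ f.push μ' := fun _ =>
  le_push hμ' fun ψ hψ => (push_le hμ hψ).trans (h ψ)

lemma push_maxFunctional_le [Nonempty X] : f.push (maxFunctional (X := X)) ≤ maxFunctional := by
  intro φ
  refine (push_le isPositiveStrongSubmeasure_maxFunctional
    (ψ := ContinuousMap.const X (maxFunctional φ)) fun x => ?_).trans_eq (maxFunctional_const _)
  exact (f.pullback_mono (ψ := ContinuousMap.const Y (maxFunctional φ))
    (le_maxFunctional φ) x).trans_eq (f.pullback_const _ x)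

end Push

section SelfMaps

variable {X : Type*} [TopologicalSpace X] {f : OpenDenseMap X X}

lemma nonempty_infinityGraph [Nonempty X] (hf : f.IsGood) : Nonempty f.infinityGraph := by
  obtain ⟨x, hx⟩ := hf.1.nonempty
  exact ⟨_, subset_closure (mem_image_of_mem _ hx)⟩

/-- The defining inequality of the pullback passes from orbits to their closure. -/
lemma comp_shift_le_of_pullback_le {φ ψ : C(X, ℝ)} (h : ∀ x, f.pullback φ x ≤ ψ x) :
    (φ.comp f.proj).comp f.shift ≤ ψ.comp f.proj := by
  have hcl : f.infinityGraph ⊆ {s : ℕ → X | φ (s 1) ≤ ψ (s 0)} := by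
    refine closure_minimal ?_ (isClosed_le (by fun_prop) (by fun_prop))
    rintro _ ⟨x, hx, rfl⟩
    have hx0 : x ∈ f.openDom := hx 0
    have := h x
    rwa [f.pullback_of_mem hx0] at this
  exact fun s => hcl s.2

variable [CompactSpace X]

/-- Pushing forward increases `(π₁)_* ρ` if `ρ` is shift-invariant. -/
lemma le_push_pushforward_proj {ρ : C(f.infinityGraph, ℝ) → ℝ}
    (hρ : IsPositiveStrongSubmeasure ρ) (hinv : Submeasure.pushforward f.shift ρ = ρ) :
    Submeasure.pushforward f.proj ρ ≤ f.push (Submeasure.pushforward f.proj ρ) := by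
  intro φ
  refine le_push (hρ.pushforward f.proj) fun ψ hψ => ?_
  have : ρ (φ.comp f.proj) = ρ ((φ.comp f.proj).comp f.shift) := (congrFun hinv _).symm
  exact this.trans_le (hρ.mono _ _ (comp_shift_le_of_pullback_le hψ))

/-- There is a smallest `f`-invariant positive strong submeasure above `(π₁)_* ρ`, of mass `1`. -/
lemma exists_isLeast_invariant [Nonempty X] {ρ : C(f.infinityGraph, ℝ) → ℝ}
    (hρ : IsPositiveStrongSubmeasure ρ)
    (hmax : ρ ≤ maxFunctional) (h1 : ρ 1 = 1) (hinv : Submeasure.pushforward f.shift ρ = ρ)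
    [Nonempty f.infinityGraph] :
    ∃ μ, IsLeast {μ' : C(X, ℝ) → ℝ | IsPositiveStrongSubmeasure μ' ∧
      Submeasure.pushforward f.proj ρ ≤ μ' ∧ f.push μ' = μ'} μ ∧ μ 1 = 1 := by
  have hle : Submeasure.pushforward f.proj ρ ≤ maxFunctional := fun φ =>
    (hmax _).trans (ciSup_le fun s => le_maxFunctional φ (f.proj s))
  obtain ⟨μ, hμ, hμmax⟩ := exists_isLeast_fixedPoint f.push
    (fun μ hμ => isPositiveStrongSubmeasure_push hμ) (fun μ μ' hμ hμ' h => push_mono hμ hμ' h)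
    (hρ.pushforward f.proj) isPositiveStrongSubmeasure_maxFunctional hle
    (le_push_pushforward_proj hρ hinv) push_maxFunctional_le
  refine ⟨μ, hμ, le_antisymm ((hμmax 1).trans_eq (maxFunctional_const 1)) ?_⟩
  exact h1.symm.trans_le (hμ.1.2.1 1)

end SelfMaps

section MetricSpace

variable {X : Type*} [MetricSpace X] [CompactSpace X] [MeasurableSpace X] [BorelSpace X]
  (f : OpenDenseMap X X)

lemma entropy_le_topEntropy (μ : C(X, ℝ) → ℝ) : f.entropy μ ≤ f.topEntropy := by
  rw [OpenDenseMap.topEntropy, ← iSup_measureEntropy_eq_topEntropy]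
  exact biSup_mono fun ν hν => hν.1

/-- If `ρ` is the supremum of all shift-invariant measures, then every functional above `(π₁)_* ρ`
has full entropy. -/
lemma entropy_eq_topEntropy {ρ : C(f.infinityGraph, ℝ) → ℝ}
    (hρ : IsSupOfMeasures (invariantMeasures f.shift) ρ) {μ : C(X, ℝ) → ℝ}
    (hμ : Submeasure.pushforward f.proj ρ ≤ μ) : f.entropy μ = f.topEntropy := by
  refine (f.entropy_le_topEntropy μ).antisymm ?_
  rw [OpenDenseMap.topEntropy, ← iSup_measureEntropy_eq_topEntropy]
  exact biSup_mono fun ν hν => ⟨hν, fun φ =>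
    ((hρ (φ.comp f.proj)).1 (mem_image_of_mem _ hν)).trans (hμ φ)⟩

end MetricSpace

end OpenDenseMap

end

end Submeasure

theorem mainTheorem3 :
    (∀ (X : Type u) [TopologicalSpace X] [CompactSpace X] [T2Space X] [Nonempty X]
        [MeasurableSpace X] [BorelSpace X] (f : C(X, X)),
      (∀ μ : C(X, ℝ) → ℝ, Submeasure.IsPositiveStrongSubmeasure μ → μ 1 = 1 →
        Submeasure.pushforward f μ = μ → Submeasure.entropy f μ ≤ Submeasure.topEntropy f) ∧
      ∃ μ : C(X, ℝ) → ℝ,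
        Submeasure.IsSupOfMeasures (Submeasure.invariantMeasures f) μ ∧
        Submeasure.IsPositiveStrongSubmeasure μ ∧ μ 1 = 1 ∧ Submeasure.pushforward f μ = μ ∧
        Submeasure.entropy f μ = Submeasure.topEntropy f) ∧
    (∀ (X : Type v) [MetricSpace X] [CompactSpace X] [Nonempty X]
        [MeasurableSpace X] [BorelSpace X] (f : Submeasure.OpenDenseMap X X), f.IsGood →
      (∀ μ : C(X, ℝ) → ℝ, Submeasure.IsPositiveStrongSubmeasure μ → μ 1 = 1 →
        f.push μ = μ → f.entropy μ ≤ f.topEntropy) ∧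
      ∃ ρ : C(f.infinityGraph, ℝ) → ℝ,
        Submeasure.IsSupOfMeasures (Submeasure.invariantMeasures f.shift) ρ ∧
        Submeasure.IsPositiveStrongSubmeasure ρ ∧ ρ 1 = 1 ∧
        Submeasure.pushforward f.shift ρ = ρ ∧
        Submeasure.entropy f.shift ρ = f.topEntropy ∧
        ∃ μ : C(X, ℝ) → ℝ,
          IsLeast {μ' : C(X, ℝ) → ℝ | Submeasure.IsPositiveStrongSubmeasure μ' ∧
            Submeasure.pushforward f.proj ρ ≤ μ' ∧ f.push μ' = μ'} μ ∧
          μ 1 = 1 ∧ f.entropy μ = f.topEntropy) := by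
  refine ⟨fun X _ _ _ _ _ _ f => ⟨fun μ _ _ _ => Submeasure.entropy_le_topEntropy f μ, ?_⟩,
    fun X _ _ _ _ _ f hf => ⟨fun μ _ _ _ => f.entropy_le_topEntropy μ, ?_⟩⟩
  · obtain ⟨μ, hsup, hμ, -, h1, hinv, hent⟩ :=
      Submeasure.exists_isSupOfMeasures_invariantMeasures f
    exact ⟨μ, hsup, hμ, h1, hinv, hent⟩
  · have := Submeasure.OpenDenseMap.nonempty_infinityGraph hf
    obtain ⟨ρ, hsup, hρ, hmax, h1, hinv, hent⟩ :=
      Submeasure.exists_isSupOfMeasures_invariantMeasures f.shift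
    obtain ⟨μ, hμ, hμ1⟩ := Submeasure.OpenDenseMap.exists_isLeast_invariant hρ hmax h1 hinv
    exact ⟨ρ, hsup, hρ, h1, hinv, hent, μ, hμ, hμ1, f.entropy_eq_topEntropy hsup hμ.1.2.1⟩
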